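/- All digraphs are finite, and $n$ denotes the number of vertices. For a digraph $G$, a set $I=\{(s_1,t_1),\dots,(s_k,t_k)\}$ of $k$ pairs of vertices (the demands) and an integer $c\ge 1$, a $c$-routing of $I$ consists of paths $P_1,\dots,P_k$ in $G$ (with no repeated vertices) such that $P_i$ leads from $s_i$ to $t_i$ for every $i$ and every vertex of $G$ lies on at most $c$ of the paths $P_1,\dots,P_k$. The $(k,c)$-Congestion Routing problem asks, given $G$ and $I$, whether a $c$-routing of $I$ exists in $G$. Theorem. For every fixed $d\ge 1$, the $(k,k-d)$-Congestion Routing problem on acyclic digraphs can be solved in time $n^{O(d)}$. That is, there is a constant $C$ such that for every $d\ge 1$ there is an algorithm (a program of a unit-cost random access machine with addition and subtraction) which, given any acyclic digraph $G$ by its adjacency matrix, together with any set $I$ of $k$ demands, where $k$ is any number with $k-d\ge 1$, decides in at most $n^{C d}$ steps whether $G$ has a $(k-d)$-routing of $I$. In particular the exponent depends only on $d$ and not on $k$. -/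

import Mathlib

/-! ### Acyclic digraphs, paths and routings -/

namespace CongestionRouting

/-- A digraph is acyclic if no vertex can be reached from itself along one or more edges.
In particular an acyclic digraph has no loops. -/
def IsAcyclic {V : Type*} (G : Digraph V) : Prop :=
  ∀ v : V, ¬ Relation.TransGen G.Adj v v

/-- The sequence `P` of vertices is a path of `G` that links `s` to `t`: its vertices are pairwise
distinct, consecutive vertices are joined by an edge, the first vertex is `s` and the last one is
`t`. For `s = t` this is the one-vertex path. -/
def Links {V : Type*} (G : Digraph V) (P : List V) (s t : V) : Prop :=
  P.Nodup ∧ P.IsChain G.Adj ∧ P.head? = some s ∧ P.getLast? = some t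

/-- `P 0, …, P (k - 1)` is a `c`-routing of the demands `D 0, …, D (k - 1)`: path `P i` links the
source of demand `i` to its target, and no vertex lies on more than `c` of the `k` paths. -/
def IsRouting {V : Type*} (G : Digraph V) (c : ℕ) {k : ℕ} (D : Fin k → V × V)
    (P : Fin k → List V) : Prop :=
  (∀ i, Links G (P i) (D i).1 (D i).2) ∧ ∀ v : V, {i : Fin k | v ∈ P i}.ncard ≤ c

/-- The question of congestion routing: is there a `c`-routing of `D` in `G`? -/
def HasRouting {V : Type*} (G : Digraph V) (c : ℕ) {k : ℕ} (D : Fin k → V × V) : Prop :=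
  ∃ P : Fin k → List V, IsRouting G c D P

end CongestionRouting

/-! ### Random access machines with unit cost -/

namespace RAM

/-- A configuration of the data of a random access machine: registers `0, 1, 2, …`, which a program
addresses by name, and memory cells `0, 1, 2, …`, which it addresses indirectly. Each register and
each cell holds a natural number. -/
structure State where
  reg : ℕ → ℕ
  mem : ℕ → ℕ

/-- `r[x] := a`. -/
def State.set (σ : State) (x a : ℕ) : State :=
  { σ with reg := Function.update σ.reg x a }

/-- `mem[i] := a`. -/
def State.write (σ : State) (i a : ℕ) : State :=
  { σ with mem := Function.update σ.mem i a }

/-- Programs of the random access machine. The arithmetic operations are addition and (truncated)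
subtraction only, so the uniform cost measure below is polynomially related to the number of steps
of a Turing machine. -/
inductive Prog where
  /-- `r[x] := a` for a constant `a` -/
  | const (x a : ℕ)
  /-- `r[x] := r[y] + r[z]` -/
  | add (x y z : ℕ)
  /-- `r[x] := max (r[y] - r[z]) 0` -/
  | sub (x y z : ℕ)
  /-- `r[x] := mem[r[y]]` -/
  | load (x y : ℕ)
  /-- `mem[r[x]] := r[y]` -/
  | store (x y : ℕ)
  /-- `p; q` -/
  | seq (p q : Prog)
  /-- `if r[x] ≠ 0 then p else q` -/
  | ite (x : ℕ) (p q : Prog)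
  /-- `while r[x] ≠ 0 do p` -/
  | loop (x : ℕ) (p : Prog)

/-- `Exec p σ τ t`: started in `σ`, the program `p` halts in `τ` after exactly `t` steps. Every
elementary instruction and every evaluation of the test of a branch or of a loop is one step. -/
inductive Exec : Prog → State → State → ℕ → Prop where
  | const (x a : ℕ) (σ : State) : Exec (.const x a) σ (σ.set x a) 1
  | add (x y z : ℕ) (σ : State) : Exec (.add x y z) σ (σ.set x (σ.reg y + σ.reg z)) 1
  | sub (x y z : ℕ) (σ : State) : Exec (.sub x y z) σ (σ.set x (σ.reg y - σ.reg z)) 1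
  | load (x y : ℕ) (σ : State) : Exec (.load x y) σ (σ.set x (σ.mem (σ.reg y))) 1
  | store (x y : ℕ) (σ : State) : Exec (.store x y) σ (σ.write (σ.reg x) (σ.reg y)) 1
  | seq {p q : Prog} {σ τ ρ : State} {t u : ℕ} (hp : Exec p σ τ t) (hq : Exec q τ ρ u) :
      Exec (.seq p q) σ ρ (t + u)
  | ite_true {x : ℕ} {p q : Prog} {σ τ : State} {t : ℕ} (hx : σ.reg x ≠ 0)
      (hp : Exec p σ τ t) : Exec (.ite x p q) σ τ (t + 1)
  | ite_false {x : ℕ} {p q : Prog} {σ τ : State} {t : ℕ} (hx : σ.reg x = 0)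
      (hq : Exec q σ τ t) : Exec (.ite x p q) σ τ (t + 1)
  | loop_done {x : ℕ} {p : Prog} {σ : State} (hx : σ.reg x = 0) : Exec (.loop x p) σ σ 1
  | loop_step {x : ℕ} {p : Prog} {σ τ ρ : State} {t u : ℕ} (hx : σ.reg x ≠ 0)
      (hp : Exec p σ τ t) (hq : Exec (.loop x p) τ ρ u) : Exec (.loop x p) σ ρ (t + u + 1)

/-- The machine is deterministic: final state and number of steps are determined by the program
and the initial state. -/
theorem Exec.unique {p : Prog} {σ τ τ' : State} {t t' : ℕ} (h : Exec p σ τ t)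
    (h' : Exec p σ τ' t') : τ = τ' ∧ t = t' := by
  induction h generalizing τ' t' with
  | const | add | sub | load | store => cases h'; exact ⟨rfl, rfl⟩
  | seq _ _ ihp ihq =>
    cases h' with
    | seq hp hq =>
      obtain ⟨rfl, rfl⟩ := ihp hp
      obtain ⟨rfl, rfl⟩ := ihq hq
      exact ⟨rfl, rfl⟩
  | ite_true hx _ ih =>
    cases h' with
    | ite_true _ hp => obtain ⟨rfl, rfl⟩ := ih hp; exact ⟨rfl, rfl⟩
    | ite_false hx' _ => exact absurd hx' hx
  | ite_false hx _ ih =>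
    cases h' with
    | ite_true hx' _ => exact absurd hx hx'
    | ite_false _ hp => obtain ⟨rfl, rfl⟩ := ih hp; exact ⟨rfl, rfl⟩
  | loop_done hx =>
    cases h' with
    | loop_done _ => exact ⟨rfl, rfl⟩
    | loop_step hx' _ _ => exact absurd hx hx'
  | loop_step hx _ _ ihp ihq =>
    cases h' with
    | loop_done hx' => exact absurd hx' hx
    | loop_step _ hp hq =>
      obtain ⟨rfl, rfl⟩ := ihp hp
      obtain ⟨rfl, rfl⟩ := ihq hq
      exact ⟨rfl, rfl⟩

end RAM

namespace CongestionRouting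

open Classical in
/-- The memory that holds the input: first the adjacency matrix of `G`, row by row, then the list
`s 0, t 0, s 1, t 1, …` of sources and targets of the demands, then zeros. -/
noncomputable def inputMem {n k : ℕ} (G : Digraph (Fin n)) (D : Fin k → Fin n × Fin n) (a : ℕ) :
    ℕ :=
  if h : a < n * n then
    if G.Adj ⟨a / n, Nat.div_lt_of_lt_mul h⟩
        ⟨a % n, Nat.mod_lt a (Nat.pos_of_mul_pos_left (Nat.zero_lt_of_lt h))⟩ then 1 else 0
  else if h : (a - n * n) / 2 < k then
    if (a - n * n) % 2 = 0 then ((D ⟨(a - n * n) / 2, h⟩).1 : ℕ)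
    else ((D ⟨(a - n * n) / 2, h⟩).2 : ℕ)
  else 0

/-- The initial state on input `G` and `D`: register `0` holds the number `n` of vertices, register
`1` the number `k` of demands, all other registers are `0`, and the memory holds the input. -/
noncomputable def inputState {n k : ℕ} (G : Digraph (Fin n)) (D : Fin k → Fin n × Fin n) :
    RAM.State where
  reg := fun x => if x = 0 then n else if x = 1 then k else 0
  mem := inputMem G D

open Classical in
/-- The program `p` solves the `(k, k - d)`-congestion routing problem on acyclic digraphs, for all
`k` with `k - d ≥ 1` at once, within time `T n`, where `n` is the number of vertices: on every
acyclic digraph with every set of `k` (pairwise distinct) demands it halts after at most `T n`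
steps, and then register `0` holds `1` if there is a `(k - d)`-routing, and `0` otherwise. -/
def SolvesInTime (p : RAM.Prog) (d : ℕ) (T : ℕ → ℕ) : Prop :=
  ∀ (n k : ℕ) (G : Digraph (Fin n)) (D : Fin k → Fin n × Fin n),
    IsAcyclic G → Function.Injective D → d < k →
      ∃ (τ : RAM.State) (t : ℕ), RAM.Exec p (inputState G D) τ t ∧ t ≤ T n ∧
        τ.reg 0 = if HasRouting G (k - d) D then 1 else 0

end CongestionRouting

/-! Call a vertex full if it lies on exactly `c = k - d` paths of a routing; it is then missed by
exactly `d` paths. If `k > 3 * d`, any three full vertices lie on a common path (`exists_common`),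
so the full vertices are linearly ordered by reachability. Take a path through the first and the
last of them. If it misses a full vertex `v`, let `x` and `y` be its nearest full vertices before
and after `v`, and exchange its `x`-`y` segment with that of a path through `x`, `v` and `y`. By
acyclicity the results are paths again, all congestions are unchanged, and the chosen path meets
more full vertices than before. Once it meets all of them (`exists_path_through_full`), deleting it
lowers `k` and `c` together by one. So some `m = min k (3 * d)` demands have an `(m - d)`-routing.
Conversely, the other `k - m` demands can be added back along arbitrary paths, each raising a
congestion by at most one (`hasRouting_iff_exists_embedding`).

Few demands are handled by a pebbling game: a pebble moves only away from a vertex that no pebble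
can reach any more. When the first pebble leaves a vertex, all pebbles that ever visit it stand on
it, so congestion is checked locally (`Completes.of_moves`, `Completes.exists_moves`). The positions
of the pebbles together with their demands form a number with `2 * m` digits in base `B = n + k +
2`, hence below `L = B ^ (6 * d)`; a single table over all codes treats every choice of `m` demands
at once (`exists_start_iff`).

The algorithm is written in a small language whose loops all run through the numbers below `L`, so a
fixed command takes polynomially many steps in `L` (`Cmd.runs_compile`, `Cmd.polyBounded_cost`). The
transitive closure and the table of configurations are least fixed points, reached by repeated
passes (`iterate_pass_spec`). The main command is the same for all `d`, so the exponent of the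
polynomial is universal; since the demands are distinct, `k ≤ n * n`, and the bound becomes a power
of `n` with exponent linear in `d`. -/

namespace RAM

/-! ### Total correctness with time bounds -/

/-- Started in `σ`, the program `p` halts within `T` steps in a state that satisfies `Q`. -/
def Runs (p : Prog) (σ : State) (T : ℕ) (Q : State → Prop) : Prop :=
  ∃ (τ : State) (t : ℕ), Exec p σ τ t ∧ t ≤ T ∧ Q τ

theorem Runs.mono {p : Prog} {σ : State} {T T' : ℕ} {Q Q' : State → Prop} (h : Runs p σ T Q)
    (hT : T ≤ T') (hQ : ∀ τ, Q τ → Q' τ) : Runs p σ T' Q' := by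
  obtain ⟨τ, t, he, ht, hq⟩ := h
  exact ⟨τ, t, he, ht.trans hT, hQ τ hq⟩

theorem Runs.const {x a : ℕ} {σ : State} {Q : State → Prop} (h : Q (σ.set x a)) :
    Runs (.const x a) σ 1 Q := ⟨_, _, .const x a σ, le_rfl, h⟩

theorem Runs.add {x y z : ℕ} {σ : State} {Q : State → Prop}
    (h : Q (σ.set x (σ.reg y + σ.reg z))) : Runs (.add x y z) σ 1 Q :=
  ⟨_, _, .add x y z σ, le_rfl, h⟩

theorem Runs.sub {x y z : ℕ} {σ : State} {Q : State → Prop}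
    (h : Q (σ.set x (σ.reg y - σ.reg z))) : Runs (.sub x y z) σ 1 Q :=
  ⟨_, _, .sub x y z σ, le_rfl, h⟩

theorem Runs.load {x y : ℕ} {σ : State} {Q : State → Prop}
    (h : Q (σ.set x (σ.mem (σ.reg y)))) : Runs (.load x y) σ 1 Q :=
  ⟨_, _, .load x y σ, le_rfl, h⟩

theorem Runs.store {x y : ℕ} {σ : State} {Q : State → Prop}
    (h : Q (σ.write (σ.reg x) (σ.reg y))) : Runs (.store x y) σ 1 Q :=
  ⟨_, _, .store x y σ, le_rfl, h⟩

theorem Runs.seq {p q : Prog} {σ : State} {T U : ℕ} {Q : State → Prop}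
    (h : Runs p σ T fun τ => Runs q τ U Q) : Runs (.seq p q) σ (T + U) Q := by
  obtain ⟨τ, t, he, ht, ρ, u, hf, hu, hq⟩ := h
  exact ⟨ρ, t + u, .seq he hf, by omega, hq⟩

theorem Runs.ite {x : ℕ} {p q : Prog} {σ : State} {T U : ℕ} {Q : State → Prop}
    (hp : σ.reg x ≠ 0 → Runs p σ T Q) (hq : σ.reg x = 0 → Runs q σ U Q) :
    Runs (.ite x p q) σ (T + U + 1) Q := by
  by_cases hx : σ.reg x = 0
  · obtain ⟨τ, t, he, ht, h⟩ := hq hx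
    exact ⟨τ, t + 1, .ite_false hx he, by omega, h⟩
  · obtain ⟨τ, t, he, ht, h⟩ := hp hx
    exact ⟨τ, t + 1, .ite_true hx he, by omega, h⟩

/-- A loop whose body decreases the register `h` by one. -/
theorem Runs.countdown {h : ℕ} {p : Prog} {K : ℕ} (N : ℕ) (I : ℕ → State → Prop)
    (hstep : ∀ i < N, ∀ σ, I i σ → σ.reg h = N - i →
      Runs p σ K fun τ => I (i + 1) τ ∧ τ.reg h = N - (i + 1)) {σ : State} (h0 : I 0 σ)
    (hN : σ.reg h = N) :
    Runs (.loop h p) σ (N * (K + 1) + 1) fun τ => I N τ ∧ τ.reg h = 0 := by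
  -- Generalised to a start after `i` rounds, for induction on the number `j` of remaining rounds.
  have key : ∀ j i, i + j = N → ∀ σ, I i σ → σ.reg h = N - i →
      Runs (.loop h p) σ (j * (K + 1) + 1) fun τ => I N τ ∧ τ.reg h = 0 := by
    intro j
    induction j with
    | zero =>
      intro i hi σ hI hr
      have : i = N := by omega
      subst this
      have hz : σ.reg h = 0 := by omega
      exact ⟨σ, 1, .loop_done hz, by omega, hI, hz⟩
    | succ j ih =>
      intro i hi σ hI hr
      obtain ⟨τ, t, he, ht, hI', hr'⟩ := hstep i (by omega) σ hI hr
      obtain ⟨ρ, u, hf, hu, hq⟩ := ih (i + 1) (by omega) τ hI' hr'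
      refine ⟨ρ, t + u + 1, .loop_step (by omega) he hf, ?_, hq⟩
      rw [Nat.add_mul]
      omega
  exact key N 0 (by omega) σ h0 (by simpa using hN)

@[simp] theorem State.set_reg (σ : State) (x a y : ℕ) :
    (σ.set x a).reg y = if y = x then a else σ.reg y := by
  simp [State.set, Function.update_apply]

@[simp] theorem State.set_mem (σ : State) (x a : ℕ) : (σ.set x a).mem = σ.mem := rfl

@[simp] theorem State.write_reg (σ : State) (x a : ℕ) : (σ.write x a).reg = σ.reg := rfl

@[simp] theorem State.write_mem (σ : State) (x a : ℕ) :
    (σ.write x a).mem = Function.update σ.mem x a := rfl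

/-! ### Expressions -/

/-- Expressions over variables and memory. Loops that evaluate `mul`, `div` and `sum` run
through the numbers below one fixed limit. -/
inductive Expr where
  | const (a : ℕ)
  | var (v : ℕ)
  | add (a b : Expr)
  | sub (a b : Expr)
  | mul (a b : Expr)
  | div (a b : Expr)
  | load (a : Expr)
  | ite (c a b : Expr)
  /-- the sum of `a` over all values of the variable `x` below the limit -/
  | sum (x : ℕ) (a : Expr)

/-- Division of `a` by `b` with at most `L` subtractions. -/
def divFuel (b : ℕ) : ℕ → ℕ → ℕ
  | 0, _ => 0
  | L + 1, a => if b ≤ a then divFuel b L (a - b) + 1 else 0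

/-- Each subtraction lowers the dividend by at least one, so `L ≥ a` rounds suffice. -/
theorem divFuel_eq {b : ℕ} (hb : 0 < b) (L a : ℕ) (h : a ≤ L) : divFuel b L a = a / b := by
  induction L generalizing a with
  | zero => simp [divFuel, Nat.le_zero.1 h]
  | succ L ih =>
    rw [divFuel]
    split_ifs with hab
    · rw [ih _ (by omega), Nat.div_eq_sub_div hb hab]
    · rw [Nat.div_eq_of_lt (by omega)]

/-- The value of an expression, for the limit `L`. -/
def Expr.eval (L : ℕ) (μ : ℕ → ℕ) : Expr → (ℕ → ℕ) → ℕ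
  | .const a, _ => a
  | .var v, ρ => ρ v
  | .add a b, ρ => a.eval L μ ρ + b.eval L μ ρ
  | .sub a b, ρ => a.eval L μ ρ - b.eval L μ ρ
  | .mul a b, ρ => min (a.eval L μ ρ) L * b.eval L μ ρ
  | .div a b, ρ => divFuel (b.eval L μ ρ) L (a.eval L μ ρ)
  | .load a, ρ => μ (a.eval L μ ρ)
  | .ite c a b, ρ => if c.eval L μ ρ ≠ 0 then a.eval L μ ρ else b.eval L μ ρ
  | .sum x a, ρ => ∑ i ∈ Finset.range L, a.eval L μ (Function.update ρ x i)

/-- The register of temporary `t`. Variable `v` lives in register `2 * v`, and the limit in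
temporary `0`. -/
abbrev tmp (t : ℕ) : ℕ := 2 * t + 1

/-- Multiplies temporaries `t` and `t + 1`. -/
def mulProg (t : ℕ) : Prog :=
  .seq (.const (tmp (t + 2)) 0) <| .seq (.add (tmp (t + 3)) (tmp 0) (tmp (t + 2))) <|
  .seq (.const (tmp (t + 4)) 1) <| .seq
    (.loop (tmp (t + 3)) <|
      .seq (.ite (tmp t) (.add (tmp (t + 2)) (tmp (t + 2)) (tmp (t + 1)))
        (.const (tmp (t + 5)) 0)) <|
      .seq (.sub (tmp t) (tmp t) (tmp (t + 4)))
        (.sub (tmp (t + 3)) (tmp (t + 3)) (tmp (t + 4))))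
    (.add (tmp t) (tmp (t + 2)) (tmp (t + 3)))

/-- Divides temporary `t` by temporary `t + 1`. -/
def divProg (t : ℕ) : Prog :=
  .seq (.const (tmp (t + 2)) 0) <| .seq (.add (tmp (t + 3)) (tmp 0) (tmp (t + 2))) <|
  .seq (.const (tmp (t + 4)) 1) <| .seq
    (.loop (tmp (t + 3)) <|
      .seq (.sub (tmp (t + 5)) (tmp (t + 1)) (tmp t)) <|
      .seq (.ite (tmp (t + 5)) (.const (tmp (t + 5)) 0)
        (.seq (.sub (tmp t) (tmp t) (tmp (t + 1)))
          (.add (tmp (t + 2)) (tmp (t + 2)) (tmp (t + 4)))))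
        (.sub (tmp (t + 3)) (tmp (t + 3)) (tmp (t + 4))))
    (.add (tmp t) (tmp (t + 2)) (tmp (t + 3)))

/-- Compiles an expression to a program that leaves the value in temporary `t` and changes no
other register except for temporaries beyond `t`. -/
def Expr.compile : Expr → ℕ → Prog
  | .const a, t => .const (tmp t) a
  | .var v, t => .seq (.const (tmp t) 0) (.add (tmp t) (2 * v) (tmp t))
  | .add a b, t =>
    .seq (a.compile t) <| .seq (b.compile (t + 1)) <| .add (tmp t) (tmp t) (tmp (t + 1))
  | .sub a b, t =>
    .seq (a.compile t) <| .seq (b.compile (t + 1)) <| .sub (tmp t) (tmp t) (tmp (t + 1))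
  | .mul a b, t => .seq (a.compile t) <| .seq (b.compile (t + 1)) <| mulProg t
  | .div a b, t => .seq (a.compile t) <| .seq (b.compile (t + 1)) <| divProg t
  | .load a, t => .seq (a.compile t) <| .load (tmp t) (tmp t)
  | .ite c a b, t => .seq (c.compile t) <| .ite (tmp t) (a.compile t) (b.compile t)
  | .sum x a, t =>
    .seq (.const (tmp t) 0) <| .seq (.add (tmp (t + 1)) (2 * x) (tmp t)) <|
    .seq (.add (tmp (t + 2)) (tmp 0) (tmp t)) <| .seq (.const (2 * x) 0) <| .seq
      (.loop (tmp (t + 2)) <|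
        .seq (a.compile (t + 3)) <| .seq (.add (tmp t) (tmp t) (tmp (t + 3))) <|
        .seq (.const (tmp (t + 3)) 1) <| .seq (.add (2 * x) (2 * x) (tmp (t + 3)))
          (.sub (tmp (t + 2)) (tmp (t + 2)) (tmp (t + 3))))
      (.add (2 * x) (tmp (t + 1)) (tmp (t + 2)))

/-- A bound on the number of steps that the evaluation of an expression takes. -/
def Expr.cost (L : ℕ) : Expr → ℕ
  | .const _ => 1
  | .var _ => 2
  | .add a b | .sub a b => a.cost L + b.cost L + 1
  | .mul a b | .div a b => a.cost L + b.cost L + (L * 8 + 5)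
  | .load a => a.cost L + 1
  | .ite c a b => c.cost L + a.cost L + b.cost L + 1
  | .sum _ a => L * (a.cost L + 5) + 6

/-- `τ` has the memory of `σ`, its variables, and its temporaries below `t`. -/
def Keeps (t : ℕ) (σ τ : State) : Prop :=
  τ.mem = σ.mem ∧ ∀ r, r % 2 = 0 ∨ r < tmp t → τ.reg r = σ.reg r

theorem Keeps.trans {t u : ℕ} {σ τ ρ : State} (h : Keeps t σ τ) (h' : Keeps u τ ρ) (htu : t ≤ u) :
    Keeps t σ ρ := by
  refine ⟨h'.1.trans h.1, fun r hr => ?_⟩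
  rw [h'.2 r (by simp only [tmp] at *; omega), h.2 r hr]

theorem Keeps.set {t : ℕ} {σ τ : State} (h : Keeps t σ τ) {u : ℕ} (a : ℕ) (hu : t ≤ u) :
    Keeps t σ (τ.set (tmp u) a) := by
  refine ⟨h.1, fun r hr => ?_⟩
  rw [State.set_reg, if_neg (by simp only [tmp] at *; omega), h.2 r hr]

theorem Keeps.refl (t : ℕ) (σ : State) : Keeps t σ σ := ⟨rfl, fun _ _ => rfl⟩

/-- The loop makes exactly `L` rounds and adds the second factor only while the countdown of the
first has not reached zero; hence the truncation `min`. The exact bound is `L * 6 + 5`, rounded up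
so that division shares it. -/
theorem runs_mulProg (t : ℕ) (σ : State) :
    Runs (mulProg t) σ (σ.reg 1 * 8 + 5) fun τ => Keeps t σ τ ∧
      τ.reg (tmp t) = min (σ.reg (tmp t)) (σ.reg 1) * σ.reg (tmp (t + 1)) := by
  set L := σ.reg 1 with hL
  set a := σ.reg (tmp t) with ha
  set b := σ.reg (tmp (t + 1)) with hb
  refine Runs.mono (T := 1 + (1 + (1 + ((L * (5 + 1) + 1) + 1)))) ?_ (by omega) (fun _ h => h)
  refine .seq <| .const <| .seq <| .add <| .seq <| .const <| .seq <| Runs.mono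
    (Runs.countdown L (fun i τ => Keeps t σ τ ∧ τ.reg (tmp t) = a - i ∧
      τ.reg (tmp (t + 1)) = b ∧ τ.reg (tmp (t + 2)) = min a i * b ∧ τ.reg (tmp (t + 4)) = 1)
      ?_ ?_ ?_) le_rfl ?_
  · rintro i hi τ ⟨hk, h0, h1, h2, h4⟩ h3
    refine Runs.mono (T := (1 + 1 + 1) + (1 + 1)) ?_ le_rfl (fun _ h => h)
    refine .seq <| .ite (fun hx => .add <| .seq <| .sub <| .sub ?_)
      (fun hx => .const <| .seq <| .sub <| .sub ?_)
    · refine ⟨⟨((hk.set _ (by omega)).set _ (by omega)).set _ (by omega), ?_⟩, ?_⟩ <;>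
      simp [h0, h1, h2, h3, h4]
      · rw [h0] at hx
        have e1 : min a (i + 1) = i + 1 := by omega
        have e2 : min a i = i := by omega
        rw [e1, e2, Nat.add_mul]
        omega
      · omega
    · refine ⟨⟨((hk.set _ (by omega)).set _ (by omega)).set _ (by omega), ?_⟩, ?_⟩ <;>
      simp [h0, h1, h2, h3, h4]
      · rw [h0] at hx
        have e1 : min a (i + 1) = a := by omega
        have e2 : min a i = a := by omega
        rw [e1, e2]
        omega
      · omega
  · refine ⟨(((Keeps.refl t σ).set _ (by omega)).set _ (by omega)).set _ (by omega), ?_⟩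
    simp [← ha, ← hb]
  · simp [← hL]
  · rintro τ ⟨⟨hk, h0, h1, h2, h4⟩, h3⟩
    -- The loop counter is zero here, so the addition is a copy.
    refine .add ⟨hk.set _ (by omega), ?_⟩
    simp [h2, h3]

theorem runs_divProg (t : ℕ) (σ : State) :
    Runs (divProg t) σ (σ.reg 1 * 8 + 5) fun τ => Keeps t σ τ ∧
      τ.reg (tmp t) = divFuel (σ.reg (tmp (t + 1))) (σ.reg 1) (σ.reg (tmp t)) := by
  set L := σ.reg 1 with hL
  set a := σ.reg (tmp t) with ha
  set b := σ.reg (tmp (t + 1)) with hb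
  refine Runs.mono (T := 1 + (1 + (1 + ((L * (6 + 1) + 1) + 1)))) ?_ (by omega) (fun _ h => h)
  refine .seq <| .const <| .seq <| .add <| .seq <| .const <| .seq <| Runs.mono
    -- Invariant: the quotient so far plus the quotient of what is left, with the remaining fuel, is
    -- the final quotient. Rounds after the dividend has dropped below `b` change nothing.
    (Runs.countdown L (fun i τ => Keeps t σ τ ∧
      τ.reg (tmp (t + 1)) = b ∧ τ.reg (tmp (t + 4)) = 1 ∧
      τ.reg (tmp (t + 2)) + divFuel b (L - i) (τ.reg (tmp t)) = divFuel b L a)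
      ?_ ?_ ?_) le_rfl ?_
  · rintro i hi τ ⟨hk, h1, h4, h2⟩ h3
    refine Runs.mono (T := 1 + ((1 + (1 + 1) + 1) + 1)) ?_ le_rfl (fun _ h => h)
    obtain ⟨j, hj⟩ : ∃ j, L - i = j + 1 := ⟨L - i - 1, by omega⟩
    have hj' : L - (i + 1) = j := by omega
    rw [hj, divFuel] at h2
    refine .seq <| .sub <| .seq <| .ite (fun hx => .const <| .sub ?_)
      (fun hx => .seq <| .sub <| .add <| .sub ?_)
    · refine ⟨⟨((hk.set _ (by omega)).set _ (by omega)).set _ (by omega), ?_⟩, ?_⟩ <;>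
      simp [h1, h3, h4, hj, hj'] at hx ⊢
      rw [if_neg (by omega)] at h2
      rw [← h2]
      cases j <;> simp [divFuel]
      omega
    · refine ⟨⟨(((hk.set _ (by omega)).set _ (by omega)).set _ (by omega)).set _ (by omega), ?_⟩,
        ?_⟩ <;>
      simp [h1, h3, h4, hj, hj'] at hx ⊢
      rw [if_pos (by omega)] at h2
      rw [← h2]
      omega
  · refine ⟨(((Keeps.refl t σ).set _ (by omega)).set _ (by omega)).set _ (by omega), ?_⟩
    simp [← ha, ← hb]
  · simp [← hL]
  · rintro τ ⟨⟨hk, h1, h4, h2⟩, h3⟩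
    refine .add ⟨hk.set _ (by omega), ?_⟩
    simp [divFuel] at h2
    simp [h2, h3]

/-- The values of the variables. -/
def State.env (σ : State) (v : ℕ) : ℕ := σ.reg (2 * v)

theorem Keeps.env {t : ℕ} {σ τ : State} (h : Keeps t σ τ) : τ.env = σ.env :=
  funext fun v => h.2 (2 * v) (by omega)

theorem Keeps.limit {t : ℕ} {σ τ : State} (h : Keeps t σ τ) (ht : 1 ≤ t) : τ.reg 1 = σ.reg 1 :=
  h.2 1 (by simp only [tmp]; omega)

theorem Keeps.tmp {t : ℕ} {σ τ : State} (h : Keeps (t + 1) σ τ) :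
    τ.reg (tmp t) = σ.reg (tmp t) :=
  h.2 _ (by simp only [RAM.tmp]; omega)

/-- Runs the programs of two expressions and a program that combines their values. -/
theorem runs_binary {a b : Expr} {q : Prog} {t T : ℕ} (ht : 1 ≤ t) {f : ℕ → ℕ → ℕ → ℕ}
    (ha : ∀ {t}, 1 ≤ t → ∀ σ, Runs (a.compile t) σ (a.cost (σ.reg 1)) fun τ =>
      Keeps t σ τ ∧ τ.reg (tmp t) = a.eval (σ.reg 1) σ.mem σ.env)
    (hb : ∀ {t}, 1 ≤ t → ∀ σ, Runs (b.compile t) σ (b.cost (σ.reg 1)) fun τ =>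
      Keeps t σ τ ∧ τ.reg (tmp t) = b.eval (σ.reg 1) σ.mem σ.env) (σ : State)
    (hq : ∀ τ : State, τ.reg 1 = σ.reg 1 → Runs q τ T fun ρ => Keeps t τ ρ ∧
      ρ.reg (tmp t) = f (τ.reg 1) (τ.reg (tmp t)) (τ.reg (tmp (t + 1)))) :
    Runs (.seq (a.compile t) (.seq (b.compile (t + 1)) q)) σ
      (a.cost (σ.reg 1) + b.cost (σ.reg 1) + T) fun τ => Keeps t σ τ ∧
        τ.reg (tmp t) = f (σ.reg 1) (a.eval (σ.reg 1) σ.mem σ.env)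
          (b.eval (σ.reg 1) σ.mem σ.env) := by
  rw [add_assoc]
  refine .seq <| (ha ht σ).mono le_rfl ?_
  rintro τ ⟨hk, h0⟩
  have hl := hk.limit ht
  refine .seq <| (hb (by omega) τ).mono (by rw [hl]) ?_
  rintro ρ ⟨hk', h1⟩
  have hl' := hk'.limit (by omega)
  refine (hq ρ (hl'.trans hl)).mono le_rfl ?_
  rintro κ ⟨hk'', h2⟩
  refine ⟨(hk.trans hk' (by omega)).trans hk'' le_rfl, ?_⟩
  rw [h2, hk'.tmp, h0, h1, hl', hl, hk.1, hk.env]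

/-- Structural induction. The condition `1 ≤ t` protects temporary `0`, which holds the limit. -/
theorem Expr.runs_compile (e : Expr) {t : ℕ} (ht : 1 ≤ t) (σ : State) :
    Runs (e.compile t) σ (e.cost (σ.reg 1)) fun τ =>
      Keeps t σ τ ∧ τ.reg (tmp t) = e.eval (σ.reg 1) σ.mem σ.env := by
  induction e generalizing t σ with
  | const a => exact .const ⟨(Keeps.refl t σ).set _ le_rfl, by simp [Expr.eval]⟩
  | var v =>
    refine Runs.mono (T := 1 + 1) ?_ le_rfl (fun _ h => h)
    refine .seq <| .const <| .add ⟨((Keeps.refl t σ).set _ le_rfl).set _ le_rfl, ?_⟩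
    have : 2 * v ≠ tmp t := by simp only [tmp]; omega
    simp [Expr.eval, State.env, this]
  | add a b iha ihb =>
    exact runs_binary ht (f := fun _ x y => x + y) iha ihb σ fun τ _ =>
      .add ⟨(Keeps.refl t τ).set _ le_rfl, by simp⟩
  | sub a b iha ihb =>
    exact runs_binary ht (f := fun _ x y => x - y) iha ihb σ fun τ _ =>
      .sub ⟨(Keeps.refl t τ).set _ le_rfl, by simp⟩
  | mul a b iha ihb =>
    exact runs_binary ht (f := fun L x y => min x L * y) iha ihb σ fun τ h =>
      h ▸ runs_mulProg t τ
  | div a b iha ihb =>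
    exact runs_binary ht (f := fun L x y => divFuel y L x) iha ihb σ fun τ h =>
      h ▸ runs_divProg t τ
  | load a iha =>
    refine .seq <| (iha ht σ).mono le_rfl ?_
    rintro τ ⟨hk, h0⟩
    exact .load ⟨hk.set _ le_rfl, by simp [Expr.eval, h0, hk.1]⟩
  | ite c a b ihc iha ihb =>
    refine Runs.mono (T := c.cost (σ.reg 1) + (a.cost (σ.reg 1) + b.cost (σ.reg 1) + 1)) ?_
      (by simp only [Expr.cost]; omega) (fun _ h => h)
    refine .seq <| (ihc ht σ).mono le_rfl ?_
    rintro τ ⟨hk, h0⟩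
    have hl := hk.limit ht
    refine .ite (fun hx => ?_) (fun hx => ?_)
    · refine (iha ht τ).mono (by rw [hl]) ?_
      rintro ρ ⟨hk', h1⟩
      refine ⟨hk.trans hk' le_rfl, ?_⟩
      rw [h0] at hx
      rw [h1, hl, hk.1, hk.env, Expr.eval, if_pos hx]
    · refine (ihb ht τ).mono (by rw [hl]) ?_
      rintro ρ ⟨hk', h1⟩
      refine ⟨hk.trans hk' le_rfl, ?_⟩
      rw [h0] at hx
      rw [h1, hl, hk.1, hk.env, Expr.eval, if_neg (by simpa using hx)]
  | sum x a iha =>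
    set L := σ.reg 1 with hL
    have hx : ∀ s, 2 * x ≠ tmp s := fun s => by simp only [tmp]; omega
    refine Runs.mono
      (T := 1 + (1 + (1 + (1 + ((L * ((a.cost L + (1 + (1 + (1 + 1)))) + 1) + 1) + 1))))) ?_
      (by
        rw [Expr.cost, show a.cost L + (1 + (1 + (1 + 1))) + 1 = a.cost L + 5 by omega]
        omega) (fun _ h => h)
    refine .seq <| .const <| .seq <| .add <| .seq <| .add <| .seq <| .const <| .seq <| Runs.mono
      -- The summation variable is overwritten during the loop, so the invariant exempts its
      -- register and records that the old value is saved in temporary `t + 1`, from where it is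
      -- restored at the end.
      (Runs.countdown L (fun i τ => τ.mem = σ.mem ∧
        (∀ r, r ≠ 2 * x → r % 2 = 0 ∨ r < tmp t → τ.reg r = σ.reg r) ∧ τ.reg (2 * x) = i ∧
        τ.reg (tmp (t + 1)) = σ.reg (2 * x) ∧
        τ.reg (tmp t) = ∑ j ∈ Finset.range i, a.eval L σ.mem (Function.update σ.env x j))
        ?_ ?_ ?_) le_rfl ?_
    · rintro i hi τ ⟨hm, hr, hxi, hs, ha⟩ hc
      have hl : τ.reg 1 = L := hr 1 (by omega) (by simp only [tmp]; omega)
      have henv : τ.env = Function.update σ.env x i := by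
        funext v
        by_cases hv : v = x
        · subst hv
          simpa [State.env] using hxi
        · simp only [State.env, Function.update_of_ne hv]
          exact hr _ (by omega) (by omega)
      refine .seq <| (iha (t := t + 3) (by omega) τ).mono (by rw [hl]) ?_
      rintro ρ ⟨hk, h0⟩
      rw [hl, hm, henv] at h0
      have g1 := hk.2 (tmp t) (by simp only [tmp]; omega)
      have g2 := hk.2 (tmp (t + 1)) (by simp only [tmp]; omega)
      have g3 := hk.2 (tmp (t + 2)) (by simp only [tmp]; omega)
      have g4 := hk.2 (2 * x) (by omega)
      refine .seq <| .add <| .seq <| .const <| .seq <| .add <| .sub ?_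
      have hx' : ∀ s, tmp s ≠ 2 * x := fun s => (hx s).symm
      refine ⟨⟨by simp [hk.1, hm], fun r e' h => ?_, ?_, ?_, ?_⟩, ?_⟩
      · have e : ∀ s, t ≤ s → r ≠ tmp s := fun s hs => by simp only [tmp] at *; omega
        simp [e _ le_rfl, e (t + 2) (by omega), e (t + 3) (by omega), e']
        rw [hk.2 r (by simp only [tmp] at *; omega), hr r e' h]
      · simp [hx, g4, hxi]
      · simp [hx', g2, hs]
      · simp [hx', g1, ha, h0, Finset.sum_range_succ]
      · simp [hx', g3, hc]
        omega
    · have hx' : ∀ s, tmp s ≠ 2 * x := fun s => (hx s).symm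
      refine ⟨rfl, fun r e' h => ?_, by simp, by simp [hx', hx], by simp [hx']⟩
      have e : ∀ s, t ≤ s → r ≠ tmp s := fun s hs => by simp only [tmp] at *; omega
      simp [e _ le_rfl, e (t + 1) (by omega), e (t + 2) (by omega), e']
    · have hx' : ∀ s, tmp s ≠ 2 * x := fun s => (hx s).symm
      have : t ≠ 0 := by omega
      simp [hx', ← hL, this]
    · rintro τ ⟨⟨hm, hr, hxi, hs, ha⟩, hc⟩
      refine .add ⟨⟨hm, fun r h => ?_⟩, ?_⟩
      · by_cases hrx : r = 2 * x
        · subst hrx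
          simp [hs, hc]
        · rw [State.set_reg, if_neg hrx, hr r hrx h]
      · have hx' : ∀ s, tmp s ≠ 2 * x := fun s => (hx s).symm
        simp [hx', ha, Expr.eval]

end RAM

namespace RAM

/-! ### Commands -/

/-- Commands over variables and memory. The variable of a loop runs through the numbers below the
limit. -/
inductive Cmd where
  | assign (x : ℕ) (e : Expr)
  | store (a e : Expr)
  | seq (p q : Cmd)
  | loop (x : ℕ) (p : Cmd)

/-- The effect of a command on variables and memory, for the limit `L`. -/
def Cmd.eval (L : ℕ) : Cmd → (ℕ → ℕ) × (ℕ → ℕ) → (ℕ → ℕ) × (ℕ → ℕ)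
  | .assign x e, s => (Function.update s.1 x (e.eval L s.2 s.1), s.2)
  | .store a e, s => (s.1, Function.update s.2 (a.eval L s.2 s.1) (e.eval L s.2 s.1))
  | .seq p q, s => q.eval L (p.eval L s)
  | .loop x p, s => Nat.rec (Function.update s.1 x 0, s.2)
      (fun _ s => (Function.update (p.eval L s).1 x ((p.eval L s).1 x + 1), (p.eval L s).2)) L

/-- Compiles a command to a program that uses the temporaries from `t` on. -/
def Cmd.compile : Cmd → ℕ → Prog
  | .assign x e, t =>
    .seq (e.compile t) <| .seq (.const (tmp (t + 1)) 0) (.add (2 * x) (tmp t) (tmp (t + 1)))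
  | .store a e, t =>
    .seq (a.compile t) <| .seq (e.compile (t + 1)) (.store (tmp t) (tmp (t + 1)))
  | .seq p q, t => .seq (p.compile t) (q.compile t)
  | .loop x p, t =>
    .seq (.const (tmp (t + 1)) 0) <| .seq (.add (tmp t) (tmp 0) (tmp (t + 1))) <|
    .seq (.const (2 * x) 0) <| .loop (tmp t) <|
      .seq (p.compile (t + 1)) <| .seq (.const (tmp (t + 1)) 1) <|
      .seq (.add (2 * x) (2 * x) (tmp (t + 1))) (.sub (tmp t) (tmp t) (tmp (t + 1)))

/-- A bound on the number of steps that a command takes. -/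
def Cmd.cost (L : ℕ) : Cmd → ℕ
  | .assign _ e => e.cost L + 2
  | .store a e => a.cost L + e.cost L + 1
  | .seq p q => p.cost L + q.cost L
  | .loop _ p => L * (p.cost L + 4) + 4

/-- Unlike an expression, a command may change every variable and the memory; only the temporaries
below `t` survive. They include the limit and the counters of the enclosing loops. -/
theorem Cmd.runs_compile (p : Cmd) {t : ℕ} (ht : 1 ≤ t) (σ : State) :
    Runs (p.compile t) σ (p.cost (σ.reg 1)) fun τ =>
      (τ.env, τ.mem) = p.eval (σ.reg 1) (σ.env, σ.mem) ∧
      ∀ s < t, τ.reg (tmp s) = σ.reg (tmp s) := by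
  have odd : ∀ x s, tmp s ≠ 2 * x := fun x s => by simp only [tmp]; omega
  have env_eq : ∀ (τ : State) (x a : ℕ),
      State.env (τ.set (2 * x) a) = Function.update τ.env x a := by
    intro τ x a
    funext v
    simp [State.env, Function.update_apply]
  have env_tmp : ∀ (τ : State) (s a : ℕ), State.env (τ.set (tmp s) a) = τ.env := by
    intro τ s a
    funext v
    simp [State.env, (odd v s).symm]
  induction p generalizing t σ with
  | assign x e =>
    refine Runs.mono (T := e.cost (σ.reg 1) + (1 + 1)) ?_ le_rfl (fun _ h => h)
    refine .seq <| (e.runs_compile ht σ).mono le_rfl ?_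
    rintro τ ⟨hk, h0⟩
    refine .seq <| .const <| .add ⟨?_, fun s hs => ?_⟩
    · rw [env_eq, env_tmp]
      simp [Cmd.eval, h0, hk.env, hk.1]
    · have := hk.2 (tmp s) (by simp only [tmp]; omega)
      have h1 : s ≠ t + 1 := by omega
      simp [odd, this, h1]
  | store a e =>
    refine Runs.mono (T := a.cost (σ.reg 1) + (e.cost (σ.reg 1) + 1)) ?_
      (by simp only [Cmd.cost]; omega) (fun _ h => h)
    refine .seq <| (a.runs_compile ht σ).mono le_rfl ?_
    rintro τ ⟨hk, h0⟩
    have hl := hk.limit ht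
    refine .seq <| (e.runs_compile (by omega) τ).mono (by rw [hl]) ?_
    rintro ρ ⟨hk', h1⟩
    refine .store ⟨?_, fun s hs => ?_⟩
    · have : ∀ i v, State.env (ρ.write i v) = ρ.env := fun _ _ => rfl
      rw [this]
      simp [Cmd.eval, h0, h1, hk.env, hk.1, hk'.env, hk'.1, hk'.tmp, hl]
    · have h2 := hk.2 (tmp s) (by simp only [tmp]; omega)
      have h3 := hk'.2 (tmp s) (by simp only [tmp]; omega)
      simp [h2, h3]
  | seq p q ihp ihq =>
    refine .seq <| (ihp ht σ).mono le_rfl ?_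
    rintro τ ⟨h0, hk⟩
    have hl : τ.reg 1 = σ.reg 1 := hk 0 (by omega)
    refine (ihq ht τ).mono (by rw [hl]) ?_
    rintro ρ ⟨h1, hk'⟩
    exact ⟨by rw [h1, h0, hl]; rfl, fun s hs => by rw [hk' s hs, hk s hs]⟩
  | loop x p ihp =>
    set L := σ.reg 1 with hL
    let f := fun (s : (ℕ → ℕ) × (ℕ → ℕ)) =>
      (Function.update (p.eval L s).1 x ((p.eval L s).1 x + 1), (p.eval L s).2)
    refine Runs.mono
      (T := 1 + (1 + (1 + ((L * ((p.cost L + (1 + (1 + 1))) + 1) + 1))))) ?_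
      (by
        rw [Cmd.cost, show p.cost L + (1 + (1 + 1)) + 1 = p.cost L + 4 by omega]
        omega) (fun _ h => h)
    refine .seq <| .const <| .seq <| .add <| .seq <| .const <| Runs.mono
      (Runs.countdown L (fun i τ => (τ.env, τ.mem) =
          Nat.rec (Function.update σ.env x 0, σ.mem) (fun _ => f) i ∧
        ∀ s < t, τ.reg (tmp s) = σ.reg (tmp s)) ?_ ?_ ?_) le_rfl ?_
    · rintro i hi τ ⟨he, hk⟩ hc
      have hl : τ.reg 1 = L := hk 0 (by omega)
      refine .seq <| (ihp (t := t + 1) (by omega) τ).mono (by rw [hl]) ?_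
      rintro ρ ⟨h0, hk'⟩
      rw [hl] at h0
      have h1 : ρ.env = (p.eval L (τ.env, τ.mem)).1 := congrArg Prod.fst h0
      have h2 : ρ.mem = (p.eval L (τ.env, τ.mem)).2 := congrArg Prod.snd h0
      have h3 := hk' t (by omega)
      refine .seq <| .const <| .seq <| .add <| .sub ⟨⟨?_, fun s hs => ?_⟩, ?_⟩
      · have h4 : ρ.reg (2 * x) = ρ.env x := rfl
        rw [env_tmp, env_eq, env_tmp]
        simp only [State.set_mem, ← he, f, State.set_reg, (odd x _).symm, if_false, if_true,
          h4, h1, h2]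
      · have h5 : s ≠ t + 1 := by omega
        have h6 : s ≠ t := by omega
        simp [odd, h5, h6, hk' s (by omega), hk s hs]
      · simp [odd, h3, hc]
        omega
    · refine ⟨?_, fun s hs => ?_⟩
      · rw [env_eq, env_tmp, env_tmp]
        rfl
      · have h5 : s ≠ t + 1 := by omega
        have h6 : s ≠ t := by omega
        simp [odd, h5, h6]
    · simp [odd, ← hL]
    · rintro τ ⟨⟨he, hk⟩, -⟩
      exact ⟨he, hk⟩

/-! ### Polynomial bounds -/

/-- `f` is bounded by a power of its argument. -/
def PolyBounded (f : ℕ → ℕ) : Prop := ∃ K, ∀ L, 2 ≤ L → f L ≤ L ^ K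

theorem PolyBounded.const (a : ℕ) : PolyBounded fun _ => a :=
  ⟨a, fun _ hL => (Nat.lt_pow_self (by omega)).le⟩

theorem PolyBounded.id : PolyBounded fun L => L := ⟨1, fun L _ => by simp⟩

theorem PolyBounded.add {f g : ℕ → ℕ} (hf : PolyBounded f) (hg : PolyBounded g) :
    PolyBounded fun L => f L + g L := by
  obtain ⟨K, hK⟩ := hf
  obtain ⟨M, hM⟩ := hg
  -- The additional factor `L ≥ 2` pays for the two summands.
  refine ⟨K + M + 1, fun L hL => ?_⟩
  have h1 : L ^ K ≤ L ^ (K + M) := Nat.pow_le_pow_right (by omega) (by omega)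
  have h2 : L ^ M ≤ L ^ (K + M) := Nat.pow_le_pow_right (by omega) (by omega)
  calc f L + g L ≤ L ^ (K + M) * 2 := by linarith [hK L hL, hM L hL]
    _ ≤ L ^ (K + M) * L := Nat.mul_le_mul_left _ hL
    _ = L ^ (K + M + 1) := (pow_succ _ _).symm

theorem PolyBounded.mul {f g : ℕ → ℕ} (hf : PolyBounded f) (hg : PolyBounded g) :
    PolyBounded fun L => f L * g L := by
  obtain ⟨K, hK⟩ := hf
  obtain ⟨M, hM⟩ := hg
  exact ⟨K + M, fun L hL => by
    rw [pow_add]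
    exact Nat.mul_le_mul (hK L hL) (hM L hL)⟩

/-- Every loop contributes one factor `L`, so the exponent depends on the expression alone. -/
theorem Expr.polyBounded_cost (e : Expr) : PolyBounded fun L => e.cost L := by
  induction e with
  | const a => exact .const 1
  | var v => exact .const 2
  | add a b iha ihb => exact (iha.add ihb).add (.const 1)
  | sub a b iha ihb => exact (iha.add ihb).add (.const 1)
  | mul a b iha ihb => exact (iha.add ihb).add ((PolyBounded.id.mul (.const 8)).add (.const 5))
  | div a b iha ihb => exact (iha.add ihb).add ((PolyBounded.id.mul (.const 8)).add (.const 5))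
  | load a iha => exact iha.add (.const 1)
  | ite c a b ihc iha ihb => exact ((ihc.add iha).add ihb).add (.const 1)
  | sum x a iha => exact (PolyBounded.id.mul (iha.add (.const 5))).add (.const 6)

theorem Cmd.polyBounded_cost (p : Cmd) : PolyBounded fun L => p.cost L := by
  induction p with
  | assign x e => exact e.polyBounded_cost.add (.const 2)
  | store a e => exact (a.polyBounded_cost.add e.polyBounded_cost).add (.const 1)
  | seq p q ihp ihq => exact ihp.add ihq
  | loop x p ihp => exact (PolyBounded.id.mul (ihp.add (.const 4))).add (.const 4)

end RAM

namespace CongestionRouting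

/-! ### Acyclic digraphs -/

/-- The rank of `v` is the number of vertices that reach `v`. Along an edge from `u` this set grows,
and strictly so, because `u` joins it and does not reach itself. -/
theorem IsAcyclic.exists_rank {V : Type*} [Finite V] {G : Digraph V} (hG : IsAcyclic G) :
    ∃ r : V → ℕ, ∀ u v, G.Adj u v → r u < r v := by
  refine ⟨fun v => {u | Relation.TransGen G.Adj u v}.ncard, fun u v h => ?_⟩
  refine Set.ncard_lt_ncard ⟨fun w hw => Relation.TransGen.tail hw h, fun hs => ?_⟩
    (Set.toFinite _)
  exact hG u (hs (Relation.TransGen.single h))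

theorem IsAcyclic.pairwise_of_isChain {V : Type*} {G : Digraph V} {l : List V}
    (hl : l.IsChain G.Adj) : l.Pairwise (Relation.TransGen G.Adj) :=
  List.isChain_iff_pairwise.1 (hl.imp fun _ _ h => .single h)

theorem IsAcyclic.nodup_of_isChain {V : Type*} {G : Digraph V} (hG : IsAcyclic G) {l : List V}
    (hl : l.IsChain G.Adj) : l.Nodup := by
  refine (IsAcyclic.pairwise_of_isChain hl).imp ?_
  rintro a b h rfl
  exact hG _ h

theorem pairwise_rank {V : Type*} {G : Digraph V} {r : V → ℕ}
    (hr : ∀ u v, G.Adj u v → r u < r v) {l : List V}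
    (hl : l.IsChain G.Adj) : l.Pairwise fun u v => r u < r v :=
  haveI : IsTrans V fun u v => r u < r v := ⟨fun _ _ _ h h' => lt_trans h h'⟩
  List.isChain_iff_pairwise.1 (hl.imp hr)

/-- A list with increasing ranks splits at two of its elements. -/
theorem exists_split {V : Type*} {r : V → ℕ} {l : List V} (hl : l.Pairwise fun u v => r u < r v)
    {x y : V} (hx : x ∈ l) (hy : y ∈ l) (hxy : r x < r y) :
    ∃ A M Z, l = A ++ x :: (M ++ y :: Z) ∧
      (∀ v ∈ l, r x < r v → r v < r y → v ∈ M) ∧ ∀ v ∈ M, r x < r v ∧ r v < r y := by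
  obtain ⟨A, B, rfl⟩ := List.append_of_mem hx
  rw [List.pairwise_append, List.pairwise_cons] at hl
  obtain ⟨hA, ⟨hxB, hB⟩, hAB⟩ := hl
  have hyB : y ∈ B := by
    simp only [List.mem_append, List.mem_cons] at hy
    rcases hy with h | rfl | h
    · have := hAB y h x (by simp)
      omega
    · omega
    · exact h
  obtain ⟨M, Z, rfl⟩ := List.append_of_mem hyB
  rw [List.pairwise_append, List.pairwise_cons] at hB
  obtain ⟨hM, ⟨hyZ, hZ⟩, hMZ⟩ := hB
  refine ⟨A, M, Z, rfl, fun v hv h1 h2 => ?_, fun v hv => ⟨hxB v (by simp [hv]),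
    hMZ v hv y (by simp)⟩⟩
  simp only [List.mem_append, List.mem_cons] at hv
  rcases hv with h | rfl | h | rfl | h
  · have := hAB v h x (by simp)
    omega
  · omega
  · exact h
  · omega
  · have := hyZ v h
    omega

/-- The new sequence is a chain because the pieces meet at `x` and `y`; acyclicity rules out
repeated vertices, so the pieces need not be checked for disjointness. -/
theorem Links.splice {V : Type*} {G : Digraph V} (hG : IsAcyclic G) {A M M' Z A' Z' : List V}
    {x y s t s' t' : V} (h : Links G (A ++ x :: (M ++ y :: Z)) s t)
    (h' : Links G (A' ++ x :: (M' ++ y :: Z')) s' t') :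
    Links G (A ++ x :: (M' ++ y :: Z)) s t := by
  obtain ⟨-, hc, hh, hl⟩ := h
  obtain ⟨-, hc', -, -⟩ := h'
  have key : (A ++ x :: (M' ++ y :: Z)).IsChain G.Adj := by
    rw [List.isChain_split] at hc hc' ⊢
    refine ⟨hc.1, ?_⟩
    have e : ∀ (N Y : List V), x :: (N ++ y :: Y) = (x :: N) ++ y :: Y := fun _ _ => rfl
    rw [e] at hc hc' ⊢
    exact List.isChain_split.2 ⟨(List.isChain_split.1 hc'.2).1, (List.isChain_split.1 hc.2).2⟩
  refine ⟨hG.nodup_of_isChain key, key, ?_, ?_⟩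
  · rw [← hh]
    cases A <;> rfl
  · rw [← hl]
    rw [List.getLast?_append_cons, List.getLast?_append_cons, ← List.cons_append,
      ← List.cons_append, List.getLast?_append_cons, List.getLast?_append_cons]

/-! ### Removing a demand -/

/-- Congestion written as a sum of multiplicities, which is visibly invariant when two paths
exchange segments. -/
theorem ncard_mem_eq_sum_count {V : Type*} [DecidableEq V] {k : ℕ} {P : Fin k → List V}
    (hP : ∀ i, (P i).Nodup) (v : V) : {i | v ∈ P i}.ncard = ∑ i, (P i).count v := by
  have : {i | v ∈ P i} = (Finset.univ.filter fun i => v ∈ P i : Finset (Fin k)) := by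
    ext; simp
  rw [this, Set.ncard_coe_finset, Finset.card_filter]
  refine Finset.sum_congr rfl fun i _ => ?_
  rw [(hP i).count]

theorem sum_count_swap {V : Type*} [DecidableEq V] {k : ℕ} {Q : Fin k → List V} {i a : Fin k}
    (hia : i ≠ a) {L L' : List V} (v : V)
    (h : L.count v + L'.count v = (Q i).count v + (Q a).count v) :
    ∑ j, (Function.update (Function.update Q i L) a L' j).count v = ∑ j, (Q j).count v := by
  have e : ∀ R : Fin k → List V, ∑ j, (R j).count v =
      (R a).count v + ((R i).count v + ∑ j ∈ (Finset.univ.erase a).erase i, (R j).count v) := by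
    intro R
    rw [Finset.add_sum_erase _ (fun j => (R j).count v) (by simp [hia]),
      Finset.add_sum_erase _ (fun j => (R j).count v) (by simp)]
  rw [e, e Q, Finset.sum_congr rfl (g := fun j => (Q j).count v)]
  · simp [hia]
    omega
  · intro j hj
    simp only [Finset.mem_erase, Finset.mem_univ, and_true] at hj
    simp [hj.1, hj.2]

/-- If three vertices are each missed by at most `d` of more than `3 * d` paths, then some path
visits all of them. -/
theorem exists_common {V : Type*} {k c d : ℕ} (hk : k = c + d) (hd : 3 * d < k)
    {P : Fin k → List V} {x y z : V} (hx : {i | x ∈ P i}.ncard = c)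
    (hy : {i | y ∈ P i}.ncard = c) (hz : {i | z ∈ P i}.ncard = c) :
    ∃ i, x ∈ P i ∧ y ∈ P i ∧ z ∈ P i := by
  by_contra! hno
  have hcompl : ∀ u, {i | u ∈ P i}.ncard = c → {i | u ∉ P i}.ncard = d := by
    intro u hu
    have := Set.ncard_add_ncard_compl {i | u ∈ P i}
    rw [hu, Nat.card_fin] at this
    have e : {i | u ∈ P i}ᶜ = {i | u ∉ P i} := rfl
    rw [e] at this
    omega
  -- Otherwise the three sets of paths missing a vertex, of size `d` each, would cover all `k > 3 *
  -- d` paths.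
  have hu : (Set.univ : Set (Fin k)) ⊆ {i | x ∉ P i} ∪ {i | y ∉ P i} ∪ {i | z ∉ P i} := by
    intro i _
    by_cases h1 : x ∈ P i
    · by_cases h2 : y ∈ P i
      · exact .inr (hno i h1 h2)
      · exact .inl (.inr h2)
    · exact .inl (.inl h1)
  have h1 := Set.ncard_le_ncard hu (Set.toFinite _)
  have h2 := Set.ncard_union_le ({i | x ∉ P i} ∪ {i | y ∉ P i}) {i | z ∉ P i}
  have h3 := Set.ncard_union_le {i | x ∉ P i} {i | y ∉ P i}
  rw [Set.ncard_univ, Nat.card_fin] at h1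
  rw [hcompl x hx, hcompl y hy] at h3
  rw [hcompl z hz] at h2
  omega

/-- If `3 * d < k`, then a `(k - d)`-routing can be rerouted so that one of its paths visits all
vertices of maximal congestion. -/
theorem exists_path_through_full {V : Type*} [Fintype V] {G : Digraph V} (hG : IsAcyclic G)
    {k c d : ℕ} (hk : k = c + d) (hd : 3 * d < k) {D : Fin k → V × V} {P : Fin k → List V}
    (hP : IsRouting G c D P) :
    ∃ (Q : Fin k → List V) (i : Fin k), IsRouting G c D Q ∧
      ∀ v, {j | v ∈ Q j}.ncard = c → v ∈ Q i := by
  classical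
  obtain ⟨r, hr⟩ := hG.exists_rank
  set F : Finset V := Finset.univ.filter fun v => {j | v ∈ P j}.ncard = c with hF
  have memF : ∀ v, v ∈ F ↔ {j | v ∈ P j}.ncard = c := by simp [hF]
  rcases F.eq_empty_or_nonempty with hFe | hFne
  · refine ⟨P, ⟨0, by omega⟩, hP, fun v hv => ?_⟩
    rw [← memF, hFe] at hv
    simp at hv
  -- Two full vertices share a path, along which ranks increase strictly.
  have sep : ∀ u ∈ F, ∀ v ∈ F, r u = r v → u = v := by
    intro u hu v hv huv
    obtain ⟨i, h1, h2, -⟩ := exists_common hk hd ((memF u).1 hu) ((memF v).1 hv) ((memF v).1 hv)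
    by_contra hne
    have hp := pairwise_rank hr (hP.1 i).2.1
    have : Std.Symm fun a b => r a ≠ r b := ⟨fun _ _ h => h.symm⟩
    exact (hp.imp fun {_ _} h => h.ne).forall h1 h2 hne huv
  obtain ⟨v₀, hv₀, hmin⟩ := F.exists_min_image r hFne
  obtain ⟨v₁, hv₁, hmax⟩ := F.exists_max_image r hFne
  obtain ⟨i, hi₀, hi₁, -⟩ :=
    exists_common hk hd ((memF v₀).1 hv₀) ((memF v₁).1 hv₁) ((memF v₁).1 hv₁)
  -- Descent on the number `s` of full vertices missed by path `i`. The congestion of every vertex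
  -- is kept exactly, so `F` remains the set of full vertices throughout.
  suffices H : ∀ (s : ℕ) (Q : Fin k → List V), (∀ j, Links G (Q j) (D j).1 (D j).2) →
      (∀ v, {j | v ∈ Q j}.ncard = {j | v ∈ P j}.ncard) → v₀ ∈ Q i → v₁ ∈ Q i →
      (F.filter (· ∉ Q i)).card = s →
      ∃ Q : Fin k → List V, (∀ j, Links G (Q j) (D j).1 (D j).2) ∧
      (∀ v, {j | v ∈ Q j}.ncard = {j | v ∈ P j}.ncard) ∧ ∀ v ∈ F, v ∈ Q i by
    obtain ⟨Q, h1, h2, h3⟩ := H _ P hP.1 (fun _ => rfl) hi₀ hi₁ rfl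
    exact ⟨Q, i, ⟨h1, fun v => h2 v ▸ hP.2 v⟩, fun v hv => h3 v ((memF v).2 (h2 v ▸ hv))⟩
  intro s
  induction s using Nat.strong_induction_on with
  | _ s ih =>
  intro Q hQ hcount h0 h1 hs
  by_cases hall : ∀ v ∈ F, v ∈ Q i
  · exact ⟨Q, hQ, hcount, hall⟩
  push Not at hall
  obtain ⟨v, hvF, hvQ⟩ := hall
  have ne_rank : ∀ u ∈ F, u ∈ Q i → r u ≠ r v := fun u hu hui h =>
    hvQ (sep u hu v hvF h ▸ hui)
  -- `x` and `y` are the full vertices of path `i` closest to `v` in rank from below and from above;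
  -- they exist because path `i` contains the extreme full vertices.
  obtain ⟨x, hx, hxmax⟩ := (F.filter fun u => u ∈ Q i ∧ r u < r v).exists_max_image r
    ⟨v₀, by
      simp only [Finset.mem_filter]
      exact ⟨hv₀, h0, lt_of_le_of_ne (hmin v hvF) (ne_rank _ hv₀ h0)⟩⟩
  obtain ⟨y, hy, hymin⟩ := (F.filter fun u => u ∈ Q i ∧ r v < r u).exists_min_image r
    ⟨v₁, by
      simp only [Finset.mem_filter]
      exact ⟨hv₁, h1, lt_of_le_of_ne (hmax v hvF) (ne_rank _ hv₁ h1).symm⟩⟩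
  simp only [Finset.mem_filter] at hx hy hxmax hymin
  have full : ∀ u ∈ F, {j | u ∈ Q j}.ncard = c := fun u hu => by rw [hcount, (memF u).1 hu]
  obtain ⟨a, hax, hav, hay⟩ := exists_common hk hd (full x hx.1) (full v hvF) (full y hy.1)
  have hia : i ≠ a := fun h => hvQ (h ▸ hav)
  obtain ⟨A, M, Z, hQi, -, hM⟩ :=
    exists_split (pairwise_rank hr (hQ i).2.1) hx.2.1 hy.2.1 (hx.2.2.trans hy.2.2)
  obtain ⟨A', M', Z', hQa, hM', -⟩ :=
    exists_split (pairwise_rank hr (hQ a).2.1) hax hay (hx.2.2.trans hy.2.2)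
  have hLi := hQi ▸ hQ i
  have hLa := hQa ▸ hQ a
  set Q' := Function.update (Function.update Q i (A ++ x :: (M' ++ y :: Z))) a
    (A' ++ x :: (M ++ y :: Z')) with hQ'
  have hQ'i : Q' i = A ++ x :: (M' ++ y :: Z) := by simp [hQ', hia]
  have hlinks : ∀ j, Links G (Q' j) (D j).1 (D j).2 := by
    intro j
    by_cases hja : j = a
    · subst hja
      rw [hQ', Function.update_self]
      exact hLa.splice hG hLi
    · by_cases hji : j = i
      · subst hji
        rw [hQ'i]
        exact hLi.splice hG hLa
      · rw [hQ', Function.update_of_ne hja, Function.update_of_ne hji]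
        exact hQ j
  -- The discarded segment `M` contains no full vertex, since its ranks lie strictly between those
  -- of `x` and `y`.
  have hmono : ∀ u ∈ F, u ∈ Q i → u ∈ Q' i := by
    intro u hu hui
    have : u ∉ M := by
      intro huM
      obtain ⟨l1, l2⟩ := hM u huM
      rcases lt_or_gt_of_ne (ne_rank u hu hui) with h | h
      · have := hxmax u ⟨hu, hui, h⟩
        omega
      · have := hymin u ⟨hu, hui, h⟩
        omega
    rw [hQi] at hui
    rw [hQ'i]
    simp only [List.mem_append, List.mem_cons] at hui ⊢
    tauto
  refine ih _ ?_ Q' hlinks (fun u => ?_) (hmono _ hv₀ h0) (hmono _ hv₁ h1) rfl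
  · rw [← hs]
    refine Finset.card_lt_card ⟨fun u hu => ?_, fun hsub => ?_⟩
    · simp only [Finset.mem_filter] at hu ⊢
      exact ⟨hu.1, fun h => hu.2 (hmono u hu.1 h)⟩
    -- The descent is strict: `v` lies in the segment `M'` that path `i` receives.
    · have := hsub (Finset.mem_filter.2 ⟨hvF, hvQ⟩)
      refine (Finset.mem_filter.1 this).2 ?_
      rw [hQ'i]
      have := hM' v hav hx.2.2 hy.2.2
      simp [this]
  · rw [← hcount u, ncard_mem_eq_sum_count fun j => (hlinks j).1,
      ncard_mem_eq_sum_count fun j => (hQ j).1]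
    refine sum_count_swap hia u ?_
    rw [hQi, hQa]
    simp only [List.count_append, List.count_cons]
    omega

theorem ncard_succAbove {V : Type*} {k : ℕ} (Q : Fin (k + 1) → List V) (i : Fin (k + 1)) (v : V)
    [Decidable (v ∈ Q i)] :
    {j | v ∈ Q j}.ncard = {j | v ∈ Q (i.succAbove j)}.ncard + if v ∈ Q i then 1 else 0 := by
  classical
  have e : ∀ {m : ℕ} (R : Fin m → List V), {j | v ∈ R j}.ncard =
      ∑ j, if v ∈ R j then 1 else 0 := by
    intro m R
    have : {i | v ∈ R i} = (Finset.univ.filter fun i => v ∈ R i : Finset (Fin m)) := by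
      ext; simp
    rw [this, Set.ncard_coe_finset, Finset.card_filter]
  rw [e, e fun j => Q (i.succAbove j), Fin.sum_univ_succAbove _ i, add_comm]
  congr

/-- Among more than `3 * d` demands, some demand can be removed. -/
theorem HasRouting.exists_remove {V : Type*} [Fintype V] {G : Digraph V} (hG : IsAcyclic G)
    {k d : ℕ} (hd : 3 * d < k + 1) {D : Fin (k + 1) → V × V} (h : HasRouting G (k + 1 - d) D) :
    ∃ i : Fin (k + 1), HasRouting G (k - d) (D ∘ i.succAbove) := by
  classical
  obtain ⟨P, hP⟩ := h
  obtain ⟨Q, i, hQ, hfull⟩ :=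
    exists_path_through_full hG (c := k + 1 - d) (d := d) (by omega) hd hP
  refine ⟨i, fun j => Q (i.succAbove j), fun j => hQ.1 _, fun v => ?_⟩
  have h1 := ncard_succAbove Q i v
  have h2 := hQ.2 v
  have h3 := hfull v
  change {j | v ∈ Q (i.succAbove j)}.ncard ≤ k - d
  -- A vertex on the removed path loses one unit of congestion; any other vertex is not full and was
  -- already below the old bound.
  split_ifs at h1 with hv
  · omega
  · have : {j | v ∈ Q j}.ncard ≠ k + 1 - d := fun h => hv (h3 h)
    omega

/-- Demands are removed one at a time while more than `3 * d` are left; the gap `d` between demands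
and congestion persists. -/
theorem HasRouting.exists_embedding {V : Type*} [Fintype V] {G : Digraph V} (hG : IsAcyclic G)
    {k d : ℕ} {D : Fin k → V × V} (h : HasRouting G (k - d) D) :
    ∃ e : Fin (min k (3 * d)) → Fin k, Function.Injective e ∧
      HasRouting G (min k (3 * d) - d) (D ∘ e) := by
  induction k with
  | zero =>
    rw [Nat.zero_min]
    exact ⟨id, fun _ _ h => h, h⟩
  | succ k ih =>
    by_cases hk : 3 * d < k + 1
    · obtain ⟨i, hi⟩ := h.exists_remove hG hk
      obtain ⟨e, he, hr⟩ := ih hi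
      rw [show min (k + 1) (3 * d) = min k (3 * d) by omega]
      exact ⟨fun j => i.succAbove (e j), i.succAbove_right_injective.comp he, hr⟩
    · rw [min_eq_left (by omega)]
      exact ⟨id, fun _ _ h => h, h⟩

/-- The `k - m` demands outside the range of `e` follow arbitrary paths, so the congestion is at
most `(m - d) + (k - m) = k - d`; this uses `d ≤ m`. -/
theorem hasRouting_of_embedding {V : Type*} {G : Digraph V} {k m d : ℕ} (hdm : d ≤ m)
    {D : Fin k → V × V} (hD : ∀ i, ∃ P, Links G P (D i).1 (D i).2) {e : Fin m → Fin k}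
    (he : Function.Injective e) (h : HasRouting G (m - d) (D ∘ e)) : HasRouting G (k - d) D := by
  classical
  obtain ⟨P, hP, hc⟩ := h
  choose R hR using hD
  set Q : Fin k → List V := fun i => if h : ∃ j, e j = i then P h.choose else R i with hQ
  have hQe : ∀ j, Q (e j) = P j := by
    intro j
    have hex : ∃ j', e j' = e j := ⟨j, rfl⟩
    rw [hQ]
    simp only [dif_pos hex]
    rw [he hex.choose_spec]
  refine ⟨Q, fun i => ?_, fun v => ?_⟩
  · by_cases h : ∃ j, e j = i
    · obtain ⟨j, rfl⟩ := h
      rw [hQe]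
      exact hP j
    · simpa only [hQ, dif_neg h] using hR i
  · have hsub : {i | v ∈ Q i} ⊆ e '' {j | v ∈ P j} ∪ (Set.range e)ᶜ := by
      intro i hi
      by_cases h : ∃ j, e j = i
      · obtain ⟨j, rfl⟩ := h
        exact .inl ⟨j, by simpa [hQe] using hi, rfl⟩
      · exact .inr h
    have h1 := Set.ncard_le_ncard hsub (Set.toFinite _)
    have h2 := Set.ncard_union_le (e '' {j | v ∈ P j}) (Set.range e)ᶜ
    have h3 := Set.ncard_image_of_injective {j | v ∈ P j} he
    have h4 := Set.ncard_add_ncard_compl (Set.range e)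
    have h5 : (Set.range e).ncard = m := by
      rw [← Set.image_univ, Set.ncard_image_of_injective _ he, Set.ncard_univ, Nat.card_fin]
    have h6 := hc v
    rw [Nat.card_fin] at h4
    omega

/-- Only `min k (3 * d)` of the demands matter, apart from the existence of a path for each. -/
theorem hasRouting_iff_exists_embedding {V : Type*} [Fintype V] {G : Digraph V}
    (hG : IsAcyclic G) {k d : ℕ} (hd : d < k) {D : Fin k → V × V} :
    HasRouting G (k - d) D ↔ (∀ i, ∃ P, Links G P (D i).1 (D i).2) ∧
      ∃ e : Fin (min k (3 * d)) → Fin k, Function.Injective e ∧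
        HasRouting G (min k (3 * d) - d) (D ∘ e) :=
  ⟨fun h => ⟨fun i => h.elim fun P hP => ⟨P i, hP.1 i⟩, h.exists_embedding hG⟩,
    fun ⟨hD, _, he, h⟩ => hasRouting_of_embedding (by omega) hD he h⟩

end CongestionRouting

namespace CongestionRouting

/-! ### Pebbling

A configuration assigns to each of `m` pebbles its position, or `none` if the pebble has left the
digraph. -/

/-- Following the lists `P`, every pebble reaches a vertex at which it may leave, and no vertex is
visited by more than `c` pebbles. -/
def Completes {V : Type*} (G : Digraph V) (c : ℕ) {m : ℕ} (T : Fin m → V → Prop)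
    (p : Fin m → Option V) (P : Fin m → List V) : Prop :=
  (∀ i, (P i).head? = p i ∧ (P i).IsChain G.Adj ∧ ∀ x ∈ (P i).getLast?, T i x) ∧
    ∀ v : V, {i | v ∈ P i}.ncard ≤ c

/-- One pebble moves away from a vertex that no other pebble can reach any more and at which
there are at most `c` pebbles. -/
def Moves {V : Type*} (G : Digraph V) (c : ℕ) {m : ℕ} (T : Fin m → V → Prop)
    (p q : Fin m → Option V) : Prop :=
  ∃ j v, p j = some v ∧ (∀ i u, p i = some u → ¬ Relation.TransGen G.Adj u v) ∧
    {i | p i = some v}.ncard ≤ c ∧ (∀ i, i ≠ j → q i = p i) ∧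
    ((∃ w, q j = some w ∧ G.Adj v w) ∨ (q j = none ∧ T j v))

theorem mem_of_head?_eq {V : Type*} {l : List V} {v : V} (h : l.head? = some v) : v ∈ l :=
  List.mem_of_mem_head? (by simp [h])

theorem transGen_of_mem {V : Type*} {G : Digraph V} {l : List V} {u v : V}
    (hl : l.IsChain G.Adj) (hu : l.head? = some u) (hv : v ∈ l) (huv : v ≠ u) :
    Relation.TransGen G.Adj u v := by
  obtain ⟨l, rfl⟩ := List.head?_eq_some_iff.1 hu
  have := IsAcyclic.pairwise_of_isChain hl
  rw [List.pairwise_cons] at this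
  exact this.1 v ((List.mem_cons.1 hv).resolve_left huv)

/-- The vertex `v` is put in front of the list of the moved pebble. Only the congestion of `v` can
grow, and a pebble whose new list visits `v` already stands there, since `v` is unreachable from all
positions; the move bounds the number of such pebbles by `c`. -/
theorem Completes.of_moves {V : Type*} {G : Digraph V} {c m : ℕ} {T : Fin m → V → Prop}
    {p q : Fin m → Option V} {Q : Fin m → List V} (hpq : Moves G c T p q)
    (h : Completes G c T q Q) : ∃ P, Completes G c T p P := by
  classical
  obtain ⟨j, v, hj, hreach, hc, hne, hq⟩ := hpq
  obtain ⟨hQ, hQc⟩ := h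
  refine ⟨Function.update Q j (v :: Q j), fun i => ?_, fun u => ?_⟩
  · by_cases hij : i = j
    · subst hij
      rw [Function.update_self]
      obtain ⟨h1, h2, h3⟩ := hQ i
      rcases hq with ⟨w, hw, hvw⟩ | ⟨hw, hT⟩
      · rw [hw] at h1
        obtain ⟨l, hl⟩ := List.head?_eq_some_iff.1 h1
        rw [hl] at h2 h3 ⊢
        refine ⟨hj.symm, List.isChain_cons_cons.2 ⟨hvw, h2⟩, fun x hx => h3 x ?_⟩
        rwa [List.getLast?_cons_cons] at hx
      · rw [hw, List.head?_eq_none_iff] at h1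
        rw [h1]
        refine ⟨hj.symm, List.isChain_singleton _, fun x hx => ?_⟩
        simp only [List.getLast?_singleton, Option.mem_def, Option.some.injEq] at hx
        exact hx ▸ hT
    · rw [Function.update_of_ne hij, ← hne i hij]
      exact hQ i
  · by_cases huv : u = v
    · subst huv
      refine le_trans (Set.ncard_le_ncard (fun i hi => ?_) (Set.toFinite _)) hc
      by_cases hij : i = j
      · exact hij ▸ hj
      · have hi' : u ∈ Q i := by simpa [hij] using hi
        obtain ⟨h1, h2, -⟩ := hQ i
        rw [hne i hij] at h1
        cases hpi : p i with
        | none =>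
          rw [hpi, List.head?_eq_none_iff] at h1
          rw [h1] at hi'
          simp at hi'
        | some w =>
          rw [hpi] at h1
          by_contra hcon
          exact hreach i w hpi (transGen_of_mem h2 h1 hi' fun e => hcon (by simp [hpi, e]))
    · refine le_trans (le_of_eq (congrArg Set.ncard ?_)) (hQc u)
      ext i
      by_cases hij : i = j
      · subst hij
        simp [huv]
      · simp [hij]

/-- A pebble at a position of minimal rank may always move along its list, because reachability
raises the rank. The decrease in total length measures progress. -/
theorem Completes.exists_moves {V : Type*} [Finite V] {G : Digraph V} (hG : IsAcyclic G)
    {c m : ℕ} {T : Fin m → V → Prop} {p : Fin m → Option V} {P : Fin m → List V}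
    (h : Completes G c T p P) (hp : ∃ i, p i ≠ none) :
    ∃ q Q, Moves G c T p q ∧ Completes G c T q Q ∧
      ∑ i, (Q i).length + 1 = ∑ i, (P i).length := by
  classical
  obtain ⟨r, hr⟩ := hG.exists_rank
  have hrT : ∀ u v, Relation.TransGen G.Adj u v → r u < r v := by
    intro u v huv
    induction huv with
    | single h => exact hr _ _ h
    | tail _ h ih => exact ih.trans (hr _ _ h)
  obtain ⟨i₀, hi₀⟩ := hp
  obtain ⟨u₀, hu₀⟩ := Option.ne_none_iff_exists'.1 hi₀
  -- The default `u₀` is never used: only pebbles that are still in the digraph are compared.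
  obtain ⟨j, hj, hmin⟩ := (Finset.univ.filter fun i => p i ≠ none).exists_min_image
    (fun i => r ((p i).getD u₀)) ⟨i₀, by simp [hi₀]⟩
  simp only [Finset.mem_filter, Finset.mem_univ, true_and] at hj hmin
  obtain ⟨v, hv⟩ := Option.ne_none_iff_exists'.1 hj
  obtain ⟨hP, hPc⟩ := h
  obtain ⟨l, hl⟩ := List.head?_eq_some_iff.1 ((hP j).1.trans hv)
  refine ⟨Function.update p j l.head?, Function.update P j l,
    ⟨j, v, hv, fun i u hu huv => ?_, ?_, fun i hi => by simp [hi], ?_⟩, ⟨fun i => ?_, fun u => ?_⟩,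
    ?_⟩
  · have := hmin i (by simp [hu])
    rw [hu, hv] at this
    have h2 := hrT u v huv
    simp only [Option.getD_some] at this
    omega
  · refine le_trans (Set.ncard_le_ncard (fun i hi => ?_) (Set.toFinite _)) (hPc v)
    exact mem_of_head?_eq ((hP i).1.trans hi)
  · obtain ⟨-, h2, h3⟩ := hP j
    rw [hl] at h2 h3
    cases l with
    | nil =>
      right
      exact ⟨by simp, h3 v (by simp)⟩
    | cons w l =>
      left
      exact ⟨w, by simp, (List.isChain_cons_cons.1 h2).1⟩
  · by_cases hij : i = j
    · subst hij
      rw [Function.update_self, Function.update_self]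
      obtain ⟨-, h2, h3⟩ := hP i
      rw [hl] at h2 h3
      refine ⟨rfl, h2.tail, fun x hx => h3 x ?_⟩
      cases l with
      | nil => simp at hx
      | cons w l => rwa [List.getLast?_cons_cons]
    · rw [Function.update_of_ne hij, Function.update_of_ne hij]
      exact hP i
  · refine le_trans (Set.ncard_le_ncard (fun i hi => ?_) (Set.toFinite _)) (hPc u)
    by_cases hij : i = j
    · subst hij
      have hi' : u ∈ l := by simpa using hi
      simp [hl, hi']
    · simpa [hij] using hi
  · rw [← Finset.add_sum_erase _ _ (Finset.mem_univ j),
      ← Finset.add_sum_erase _ (fun i => (P i).length) (Finset.mem_univ j),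
      Finset.sum_congr rfl (g := fun i => (P i).length)]
    · simp [hl]
      omega
    · intro i hi
      simp [Finset.ne_of_mem_erase hi]

theorem Completes.sum_length_le {V : Type*} [Fintype V] {G : Digraph V} (hG : IsAcyclic G)
    {c m : ℕ} {T : Fin m → V → Prop} {p : Fin m → Option V} {P : Fin m → List V}
    (h : Completes G c T p P) : ∑ i, (P i).length ≤ m * Fintype.card V := by
  refine (Finset.sum_le_card_nsmul _ _ _ fun i _ =>
    (hG.nodup_of_isChain (h.1 i).2.1).length_le_card).trans ?_
  simp

/-- Chains in an acyclic digraph have no repeated vertices, and the prescribed head makes every list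
nonempty, so the condition on the last vertex is not vacuous. -/
theorem hasRouting_iff_exists_completes {V : Type*} {G : Digraph V} (hG : IsAcyclic G) {c m : ℕ}
    {D : Fin m → V × V} :
    HasRouting G c D ↔
      ∃ P, Completes G c (fun i x => x = (D i).2) (fun i => some (D i).1) P := by
  refine exists_congr fun P => and_congr (forall_congr' fun i => ?_) Iff.rfl
  refine ⟨fun ⟨_, h1, h2, h3⟩ => ⟨h2, h1, fun x hx => ?_⟩, fun ⟨h1, h2, h3⟩ =>
    ⟨hG.nodup_of_isChain h2, h2, h1, ?_⟩⟩
  · rw [h3] at hx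
    exact (Option.some.inj hx).symm
  · obtain ⟨l, hl⟩ := List.head?_eq_some_iff.1 h1
    obtain ⟨x, hx⟩ : ∃ x, (P i).getLast? = some x :=
      ⟨_, List.getLast?_eq_some_getLast (by simp [hl])⟩
    rw [hx, h3 x hx]

theorem exists_links_iff {V : Type*} {G : Digraph V} (hG : IsAcyclic G) {s t : V} :
    (∃ P, Links G P s t) ↔ s = t ∨ Relation.TransGen G.Adj s t := by
  constructor
  · rintro ⟨P, -, hc, hh, hl⟩
    by_cases hst : t = s
    · exact .inl hst.symm
    · exact .inr (transGen_of_mem hc hh (List.mem_of_getLast? hl) hst)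
  · rintro (rfl | h)
    · exact ⟨[s], by simp [Links]⟩
    · obtain ⟨l, hne, hc, hh, hl⟩ := List.exists_isChain_ne_nil_of_relationReflTransGen h.to_reflTransGen
      refine ⟨l, hG.nodup_of_isChain hc, hc, ?_, ?_⟩
      · rw [List.head?_eq_some_head hne, hh]
      · rw [List.getLast?_eq_some_getLast hne, hl]

end CongestionRouting

namespace RAM

/-! ### Derived expressions -/

namespace Expr

variable (L : ℕ) (μ : ℕ → ℕ) (ρ : ℕ → ℕ) (a b : Expr) (x : ℕ)

/-- Negation; every nonzero number counts as true. -/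
def not : Expr := .ite a (.const 0) (.const 1)

/-- Conjunction. -/
def and : Expr := .ite a b (.const 0)

/-- Disjunction. -/
def or : Expr := .ite a (.const 1) b

/-- Implication. -/
def imp : Expr := .ite a b (.const 1)

/-- `a < b` -/
def lt : Expr := .sub b a

/-- `a = b` -/
def eq : Expr := (Expr.add (.sub a b) (.sub b a)).not

/-- Universal quantification over a variable below the limit. -/
def all : Expr := (Expr.sum x a.not).not

/-- The remainder of a division. -/
def mod : Expr := .sub a (.mul b (.div a b))

/-- The expression holds. -/
def Holds (a : Expr) : Prop := a.eval L μ ρ ≠ 0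

@[simp] theorem holds_not : a.not.Holds L μ ρ ↔ ¬ a.Holds L μ ρ := by
  simp [Holds, not, eval]

@[simp] theorem holds_and : (a.and b).Holds L μ ρ ↔ a.Holds L μ ρ ∧ b.Holds L μ ρ := by
  simp [Holds, and, eval]

@[simp] theorem holds_or : (a.or b).Holds L μ ρ ↔ a.Holds L μ ρ ∨ b.Holds L μ ρ := by
  by_cases h : a.eval L μ ρ = 0 <;> simp [Holds, or, eval, h]

@[simp] theorem holds_imp : (a.imp b).Holds L μ ρ ↔ (a.Holds L μ ρ → b.Holds L μ ρ) := by
  by_cases h : a.eval L μ ρ = 0 <;> simp [Holds, imp, eval, h]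

@[simp] theorem holds_lt : (a.lt b).Holds L μ ρ ↔ a.eval L μ ρ < b.eval L μ ρ := by
  simp [Holds, lt, eval, Nat.sub_eq_zero_iff_le]

/-- The exact value is needed, and not only the truth value, because `moveE` counts pebbles by
summing equalities. -/
theorem eval_eq : (a.eq b).eval L μ ρ = if a.eval L μ ρ = b.eval L μ ρ then 1 else 0 := by
  by_cases h : a.eval L μ ρ = b.eval L μ ρ
  · simp [eq, not, eval, h]
  · have h' : (Expr.add (.sub a b) (.sub b a)).eval L μ ρ ≠ 0 := by simp only [eval]; omega
    rw [eq, not, eval, if_neg h, if_pos h', eval]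

@[simp] theorem holds_eq : (a.eq b).Holds L μ ρ ↔ a.eval L μ ρ = b.eval L μ ρ := by
  simp [Holds, eval_eq]

-- A sum of natural numbers is nonzero exactly if some summand is, so `sum` doubles as a bounded
-- existential quantifier.
@[simp] theorem holds_sum :
    (Expr.sum x a).Holds L μ ρ ↔ ∃ i < L, a.Holds L μ (Function.update ρ x i) := by
  simp [Holds, eval]

@[simp] theorem holds_all :
    (a.all x).Holds L μ ρ ↔ ∀ i < L, a.Holds L μ (Function.update ρ x i) := by
  simp [all]

theorem holds_load : (Expr.load a).Holds L μ ρ ↔ μ (a.eval L μ ρ) ≠ 0 := Iff.rfl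

theorem eval_and : (a.and b).eval L μ ρ = if a.eval L μ ρ ≠ 0 then b.eval L μ ρ else 0 := rfl

variable {L μ ρ a b}

theorem eval_mul (h : a.eval L μ ρ ≤ L) :
    (Expr.mul a b).eval L μ ρ = a.eval L μ ρ * b.eval L μ ρ := by
  rw [eval, min_eq_left h]

theorem eval_div (h : a.eval L μ ρ ≤ L) (hb : 0 < b.eval L μ ρ) :
    (Expr.div a b).eval L μ ρ = a.eval L μ ρ / b.eval L μ ρ := by
  rw [eval, divFuel_eq hb _ _ h]

theorem eval_mod (h : a.eval L μ ρ ≤ L) (hb : 0 < b.eval L μ ρ) (hbL : b.eval L μ ρ ≤ L) :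
    (a.mod b).eval L μ ρ = a.eval L μ ρ % b.eval L μ ρ := by
  rw [mod, eval, eval_mul hbL, eval_div h hb]
  exact Nat.sub_eq_of_eq_add (Nat.mod_add_div _ _).symm

/-- The variable `v` does not occur. -/
def Avoids (v : ℕ) : Expr → Prop
  | .const _ => True
  | .var w => w ≠ v
  | .add a b | .sub a b | .mul a b | .div a b => a.Avoids v ∧ b.Avoids v
  | .load a => a.Avoids v
  | .ite c a b => c.Avoids v ∧ a.Avoids v ∧ b.Avoids v
  | .sum x a => x ≠ v ∧ a.Avoids v

/-- Used to see that every pass over a table evaluates the same function, whatever the value of the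
outer loop counter. -/
theorem Avoids.eval_update {v : ℕ} {e : Expr} (h : e.Avoids v) (L : ℕ) (μ ρ : ℕ → ℕ) (i : ℕ) :
    e.eval L μ (Function.update ρ v i) = e.eval L μ ρ := by
  induction e generalizing ρ with
  | const => rfl
  | var w => simp only [eval]; exact Function.update_of_ne h _ _
  | add a b iha ihb => simp only [eval, iha h.1, ihb h.2]
  | sub a b iha ihb => simp only [eval, iha h.1, ihb h.2]
  | mul a b iha ihb => simp only [eval, iha h.1, ihb h.2]
  | div a b iha ihb => simp only [eval, iha h.1, ihb h.2]
  | load a iha => simp only [eval, iha h]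
  | ite c a b ihc iha ihb => simp only [eval, ihc h.1, iha h.2.1, ihb h.2.2]
  | sum x a iha =>
    simp only [eval]
    refine Finset.sum_congr rfl fun j _ => ?_
    rw [Function.update_comm h.1.symm, iha h.2]

end Expr

/-! ### Tables -/

/-- Sets the cells `base, …, base + x - 1` one after the other to the values of `f`. -/
def pass (base : ℕ) (f : ℕ → (ℕ → ℕ) → ℕ) : ℕ → (ℕ → ℕ) → ℕ → ℕ
  | 0, μ => μ
  | x + 1, μ => Function.update (pass base f x μ) (base + x) (f x (pass base f x μ))

theorem pass_of_notMem {base : ℕ} {f : ℕ → (ℕ → ℕ) → ℕ} (x : ℕ) (μ : ℕ → ℕ) {a : ℕ}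
    (h : a < base ∨ base + x ≤ a) : pass base f x μ a = μ a := by
  induction x with
  | zero => rfl
  | succ x ih =>
    rw [pass, Function.update_of_ne (by omega), ih (by omega)]

theorem iterate_pass_of_notMem {base L : ℕ} {f : ℕ → (ℕ → ℕ) → ℕ} (r : ℕ) (μ : ℕ → ℕ) {a : ℕ}
    (h : a < base ∨ base + L ≤ a) : (pass base f L)^[r] μ a = μ a := by
  induction r with
  | zero => rfl
  | succ r ih => rw [Function.iterate_succ_apply', pass_of_notMem _ _ h, ih]

theorem pass_congr {base : ℕ} {f g : ℕ → (ℕ → ℕ) → ℕ} (x : ℕ) (μ : ℕ → ℕ)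
    (h : ∀ y < x, ∀ μ, f y μ = g y μ) : pass base f x μ = pass base g x μ := by
  induction x with
  | zero => rfl
  | succ x ih => rw [pass, pass, ih fun y hy => h y (by omega), h x (by omega)]

/-- Repeated passes compute an inductive predicate: everything that is marked satisfies `Sound`,
and everything of rank at most the number of passes is marked. -/
theorem iterate_pass_spec {base L : ℕ} {f : ℕ → (ℕ → ℕ) → ℕ} {μ₀ : ℕ → ℕ} {Sound : ℕ → Prop}
    {Rank : ℕ → ℕ → Prop} (h0 : ∀ x, ¬ Rank 0 x) (hmono : ∀ r x, Rank r x → Rank (r + 1) x)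
    (hz : ∀ b < L, μ₀ (base + b) = 0)
    (hsound : ∀ μ : ℕ → ℕ, (∀ a, a < base ∨ base + L ≤ a → μ a = μ₀ a) → ∀ x < L,
      (∀ b < L, μ (base + b) ≠ 0 → Sound b) → f x μ ≠ 0 → Sound x)
    (hrank : ∀ μ : ℕ → ℕ, (∀ a, a < base ∨ base + L ≤ a → μ a = μ₀ a) → ∀ x < L, ∀ r,
      (∀ b < L, Rank r b → μ (base + b) ≠ 0) → Rank (r + 1) x → f x μ ≠ 0) (r : ℕ) :
    ∀ b < L, ((pass base f L)^[r] μ₀ (base + b) ≠ 0 → Sound b) ∧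
      (Rank r b → (pass base f L)^[r] μ₀ (base + b) ≠ 0) := by
  induction r with
  | zero => exact fun b hb => ⟨fun h => absurd (hz b hb) h, fun h => absurd h (h0 b)⟩
  | succ r ih =>
    rw [Function.iterate_succ_apply']
    set ν := (pass base f L)^[r] μ₀ with hν
    -- Cells are updated in place, so a test sees a mixture of old and new entries. Marks of rank
    -- `r` survive being overwritten, by `hmono`, and the cells below `x` have already reached rank
    -- `r + 1`.
    have key : ∀ x ≤ L, ∀ b < L, (pass base f x ν (base + b) ≠ 0 → Sound b) ∧
        (Rank r b → pass base f x ν (base + b) ≠ 0) ∧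
        (b < x → Rank (r + 1) b → pass base f x ν (base + b) ≠ 0) := by
      intro x
      induction x with
      | zero => exact fun _ b hb => ⟨(ih b hb).1, (ih b hb).2, fun h => absurd h (by omega)⟩
      | succ x ihx =>
        intro hx b hb
        have ihx := ihx (by omega)
        have hfr : ∀ a, a < base ∨ base + L ≤ a → pass base f x ν a = μ₀ a := fun a ha => by
          rw [pass_of_notMem _ _ (by omega), hν, iterate_pass_of_notMem _ _ ha]
        rw [pass]
        by_cases hbx : b = x
        · subst hbx
          rw [Function.update_self]
          have hr := hrank _ hfr b hb r fun b' hb' h => (ihx b' hb').2.1 h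
          exact ⟨hsound _ hfr b hb fun b' hb' h => (ihx b' hb').1 h,
            fun h => hr (hmono _ _ h), fun _ h => hr h⟩
        · rw [Function.update_of_ne (by omega)]
          exact ⟨(ihx b hb).1, (ihx b hb).2.1, fun h => (ihx b hb).2.2 (by omega)⟩
    exact fun b hb => ⟨(key L le_rfl b hb).1, (key L le_rfl b hb).2.2 hb⟩

/-- Fills a table with the values of `e`, where variable `x` is the index. -/
def tabulate (x : ℕ) (base e : Expr) : Cmd := .loop x (.store (.add base (.var x)) e)

theorem eval_tabulate {L x : ℕ} {base e : Expr} {ρ : ℕ → ℕ} {b : ℕ}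
    (hb : ∀ μ i, base.eval L μ (Function.update ρ x i) = b) (μ : ℕ → ℕ) :
    (tabulate x base e).eval L (ρ, μ) = (Function.update ρ x L,
      pass b (fun i μ => e.eval L μ (Function.update ρ x i)) L μ) := by
  simp only [tabulate, Cmd.eval]
  -- The number of rounds and the limit used for evaluation are both `L`; naming the round separates
  -- them, so that the induction varies only the former.
  generalize h : (fun (_ : ℕ) (s : (ℕ → ℕ) × (ℕ → ℕ)) => _) = F
  have : ∀ N : ℕ, (Nat.rec (Function.update ρ x 0, μ) F N : (ℕ → ℕ) × (ℕ → ℕ)) =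
      (Function.update ρ x N, pass b (fun i μ => e.eval L μ (Function.update ρ x i)) N μ) := by
    intro N
    induction N with
    | zero => rfl
    | succ N ih =>
      simp only [ih]
      rw [← h]
      simp [pass, Expr.eval, hb]
  exact this L

/-- Nested loops amount to `L` passes. The final values of the two counters are irrelevant, so the
environment is described only away from them. -/
theorem eval_loop_tabulate {L x y : ℕ} {base e : Expr} {ρ : ℕ → ℕ} {b : ℕ} (hxy : x ≠ y)
    (he : e.Avoids y) (hb : ∀ μ i j, base.eval L μ
      (Function.update (Function.update ρ y j) x i) = b) (μ : ℕ → ℕ) :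
    ∃ ρ', (∀ v, v ≠ x → v ≠ y → ρ' v = ρ v) ∧
      (Cmd.loop y (tabulate x base e)).eval L (ρ, μ) =
        (ρ', (pass b (fun i μ => e.eval L μ (Function.update ρ x i)) L)^[L] μ) := by
  rw [Cmd.eval]
  generalize h : (fun (_ : ℕ) (s : (ℕ → ℕ) × (ℕ → ℕ)) => _) = F
  have : ∀ N : ℕ, ∃ ρ', (∀ v, v ≠ x → v ≠ y → ρ' v = ρ v) ∧ ρ' y = N ∧
      (Nat.rec (Function.update ρ y 0, μ) F N : (ℕ → ℕ) × (ℕ → ℕ)) =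
      (ρ', (pass b (fun i μ => e.eval L μ (Function.update ρ x i)) L)^[N] μ) := by
    intro N
    induction N with
    | zero => exact ⟨_, fun v _ hv => Function.update_of_ne hv _ _, by simp, rfl⟩
    | succ N ih =>
      obtain ⟨ρ', h1, h2, h3⟩ := ih
      have hρ : ∀ i, Function.update ρ' x i =
          Function.update (Function.update ρ y N) x i := by
        intro i
        funext v
        by_cases hvx : v = x
        · subst hvx; simp
        · rw [Function.update_of_ne hvx, Function.update_of_ne hvx]
          by_cases hvy : v = y
          · subst hvy; simpa using h2
          · rw [Function.update_of_ne hvy, h1 v hvx hvy]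
      have h4 := eval_tabulate (L := L) (x := x) (base := base) (e := e) (ρ := ρ') (b := b)
        (fun μ i => by rw [hρ, hb]) ((pass b (fun i μ => e.eval L μ (Function.update ρ x i)) L)^[N] μ)
      refine ⟨Function.update (Function.update ρ' x L) y (N + 1), fun v hvx hvy => ?_, by simp, ?_⟩
      · rw [Function.update_of_ne hvy, Function.update_of_ne hvx, h1 v hvx hvy]
      · simp only [h3]
        rw [← h]
        simp only [h4]
        refine Prod.ext ?_ ?_
        · simp [Function.update_of_ne hxy.symm, h2]
        · rw [Function.iterate_succ_apply']
          refine pass_congr _ _ fun i _ ν => ?_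
          rw [hρ, Function.update_comm hxy.symm, he.eval_update]
  obtain ⟨ρ', h1, -, h3⟩ := this L
  exact ⟨ρ', h1, h3⟩

end RAM

namespace CongestionRouting

open RAM RAM.Expr

/-! ### The algorithm

Variables: `0` is the number `n` of vertices, `1` the number `k` of demands, `2` the limit `L`,
`3` the number `m` of pebbles, `4` the congestion `c` and `5` the base `B` of the number system in
which configurations are written. Digit `i < m` of the code of a configuration is the position of
pebble `i`, where all numbers from `n` on mean that it has left the digraph, and digit `m + i` is
the demand of pebble `i`. The memory holds the input, then from cell `L` on the powers of `B`, from
cell `2 * L` on the transitive closure of the digraph, and from cell `3 * L` on the table of the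
configurations that can be completed. -/

/-- Digit `i` of `a` in base `B`. -/
def dig (B a i : ℕ) : ℕ := a / B ^ i % B

theorem dig_lt {B : ℕ} (hB : 0 < B) (a i : ℕ) : dig B a i < B := Nat.mod_lt _ hB

theorem exists_dig_eq {B : ℕ} (N : ℕ) (f : ℕ → ℕ) (hf : ∀ i < N, f i < B) :
    ∃ a < B ^ N, ∀ i < N, dig B a i = f i := by
  induction N generalizing f with
  | zero => exact ⟨0, by simp, fun i hi => absurd hi (by omega)⟩
  | succ N ih =>
    obtain ⟨a, ha, h⟩ := ih (fun i => f (i + 1)) fun i hi => hf _ (by omega)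
    have h0 := hf 0 (by omega)
    refine ⟨f 0 + B * a, ?_, fun i hi => ?_⟩
    · calc f 0 + B * a < B * (a + 1) := by rw [mul_add]; omega
        _ ≤ B * B ^ N := Nat.mul_le_mul_left _ ha
        _ = B ^ (N + 1) := by rw [pow_succ, mul_comm]
    · cases i with
      | zero => simp [dig, Nat.mod_eq_of_lt h0]
      | succ i =>
        rw [← h i (by omega), dig, dig, pow_succ', ← Nat.div_div_eq_div_mul,
          Nat.add_mul_div_left _ _ (by omega), Nat.div_eq_of_lt h0, zero_add]

/-- The sizes are large enough. -/
structure Sizes (n k m L B : ℕ) : Prop where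
  n_lt : n < B
  k_le : k ≤ B
  m_le : m ≤ k
  pow_le : B ^ (2 * m) ≤ L
  -- Places the input, and every target address read through a digit below `B`, under cell `L`, and
  -- makes `L` passes exceed the at most `m * n` moves of a pebbling.
  sq_le : B * B + 4 * B ≤ L

/-- The variables have the values that they should have. -/
structure Setup (n k m c L B : ℕ) (ρ : ℕ → ℕ) : Prop where
  n_eq : ρ 0 = n
  k_eq : ρ 1 = k
  L_eq : ρ 2 = L
  m_eq : ρ 3 = m
  c_eq : ρ 4 = c
  B_eq : ρ 5 = B

theorem Setup.update {n k m c L B : ℕ} {ρ : ℕ → ℕ} (h : Setup n k m c L B ρ) {x : ℕ} (hx : 6 ≤ x)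
    (i : ℕ) : Setup n k m c L B (Function.update ρ x i) := by
  obtain ⟨h0, h1, h2, h3, h4, h5⟩ := h
  constructor <;> rw [Function.update_of_ne (by omega)] <;> assumption

/-- The index `u * n + v` of the pair of `u` and `v` in an `n`-by-`n` table. -/
def pairE (u v : Expr) : Expr := .add (.mul u (.var 0)) v

/-- Digit `j` of `a`. -/
def digE (a j : Expr) : Expr := (Expr.div a (.load (.add (.var 2) j))).mod (.var 5)

/-- The position of a pebble. -/
def posE (a i : ℕ) : Expr := digE (.var a) (.var i)

/-- The demand of a pebble. -/
def demE (a i : ℕ) : Expr := digE (.var a) (.add (.var 3) (.var i))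

/-- The source of a demand. -/
def srcE (e : Expr) : Expr := .load (.add (.mul (.var 0) (.var 0)) (.add e e))

/-- The target of a demand. -/
def tgtE (e : Expr) : Expr :=
  .load (.add (.mul (.var 0) (.var 0)) (.add (.add e e) (.const 1)))

/-- The entry of the transitive closure. -/
def reachE (u v : Expr) : Expr := .load (.add (.add (.var 2) (.var 2)) (pairE u v))

/-- The address of the table of configurations. -/
def tableE : Expr := .add (.add (.var 2) (.var 2)) (.var 2)

/-- The test for an entry of the transitive closure. -/
def closureE : Expr :=
  (Expr.lt (.var 7) (.mul (.var 0) (.var 0))).and <|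
    (Expr.load (.var 7)).or <| .sum 8 <|
      (Expr.lt (.var 8) (.var 0)).and <|
        (Expr.load (pairE (.div (.var 7) (.var 0)) (.var 8))).and
          (reachE (.var 8) ((Expr.var 7).mod (.var 0)))

/-- All pebbles of configuration `7` have left the digraph. -/
def doneE : Expr :=
  .all (.imp (.lt (.var 10) (.var 3)) (.not (.lt (posE 7 10) (.var 0)))) 10

/-- Moving pebble `9` leads from configuration `7` to configuration `8`. -/
def moveE : Expr :=
  (Expr.lt (posE 7 9) (.var 0)).and <|
  (Expr.all (.imp (.lt (.var 10) (.var 3)) <|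
    (Expr.imp (.lt (posE 7 10) (.var 0)) (.not (reachE (posE 7 10) (posE 7 9)))).and <|
    (Expr.imp (.not (.eq (.var 10) (.var 9))) (.eq (posE 8 10) (posE 7 10))).and <|
      .eq (demE 8 10) (demE 7 10)) 10).and <|
  (Expr.not (.lt (.var 4)
    (.sum 10 (.and (.lt (.var 10) (.var 3)) (.eq (posE 7 10) (posE 7 9)))))).and <|
  ((Expr.lt (posE 8 9) (.var 0)).and (.load (pairE (posE 7 9) (posE 8 9)))).or <|
  (Expr.not (.lt (posE 8 9) (.var 0))).and (.eq (tgtE (demE 7 9)) (posE 7 9))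

/-- The test for an entry of the table of configurations. -/
def configE : Expr :=
  doneE.or <| .sum 8 <| (Expr.load (.add tableE (.var 8))).and <|
    .sum 9 <| (Expr.lt (.var 9) (.var 3)).and moveE

/-- In configuration `7` the pebbles belong to distinct demands and are at the sources. -/
def startE : Expr :=
  .all (.imp (.lt (.var 10) (.var 3)) <|
    (Expr.lt (demE 7 10) (.var 1)).and <| (Expr.eq (srcE (demE 7 10)) (posE 7 10)).and <|
      .all (.imp (.lt (.var 11) (.var 10)) (.not (.eq (demE 7 11) (demE 7 10)))) 11) 10

/-- Every demand can be linked. -/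
def linkedE : Expr :=
  .all (.imp (.lt (.var 10) (.var 1)) <|
    (Expr.eq (srcE (.var 10)) (tgtE (.var 10))).or
      (reachE (srcE (.var 10)) (tgtE (.var 10)))) 10

/-- The answer. -/
def answerE : Expr :=
  .ite (linkedE.and (.sum 7 (startE.and (.load (.add tableE (.var 7))))))
    (.const 1) (.const 0)

/-! ### Arithmetical meaning of the expressions -/

section eval

variable {n k m c L B : ℕ} {μ ρ : ℕ → ℕ}

theorem eval_pairE (hρ : Setup n k m c L B ρ) {u v : Expr} (hu : u.eval L μ ρ ≤ L) :
    (pairE u v).eval L μ ρ = u.eval L μ ρ * n + v.eval L μ ρ := by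
  rw [pairE, eval, eval_mul hu, eval, hρ.n_eq]

/-- The bound on `a` makes the `L` subtractions of a division sufficient, and the bound on `j` keeps
the exponent within the table of powers. -/
theorem eval_digE (hs : Sizes n k m L B) (hρ : Setup n k m c L B ρ)
    (hp : ∀ j < L, μ (L + j) = B ^ j) {a j : Expr} (ha : a.eval L μ ρ ≤ L)
    (hj : j.eval L μ ρ < L) :
    (digE a j).eval L μ ρ = dig B (a.eval L μ ρ) (j.eval L μ ρ) := by
  have hB : 0 < B := by have := hs.n_lt; omega
  have hBL : B ≤ L := by have := hs.sq_le; omega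
  have h1 : (Expr.load (.add (.var 2) j)).eval L μ ρ = B ^ j.eval L μ ρ := by
    rw [eval, eval, eval, hρ.L_eq, hp _ hj]
  have h2 : (Expr.var 5).eval L μ ρ = B := by rw [eval, hρ.B_eq]
  have h3 : (Expr.div a (.load (.add (.var 2) j))).eval L μ ρ =
      a.eval L μ ρ / B ^ j.eval L μ ρ := by
    rw [eval_div ha (by rw [h1]; positivity), h1]
  rw [digE, eval_mod (by rw [h3]; exact (Nat.div_le_self _ _).trans ha) (by rwa [h2])
    (by rwa [h2]), h2, h3, dig]

theorem eval_posE (hs : Sizes n k m L B) (hρ : Setup n k m c L B ρ)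
    (hp : ∀ j < L, μ (L + j) = B ^ j) {a i : ℕ} (ha : ρ a < L) (hi : ρ i < L) :
    (posE a i).eval L μ ρ = dig B (ρ a) (ρ i) :=
  eval_digE hs hρ hp (a := .var a) (j := .var i) (by simpa [eval] using ha.le)
    (by simpa [eval] using hi)

theorem eval_demE (hs : Sizes n k m L B) (hρ : Setup n k m c L B ρ)
    (hp : ∀ j < L, μ (L + j) = B ^ j) {a i : ℕ} (ha : ρ a < L) (hi : ρ i < m) :
    (demE a i).eval L μ ρ = dig B (ρ a) (m + ρ i) := by
  have h : (Expr.add (.var 3) (.var i)).eval L μ ρ = m + ρ i := by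
    rw [eval, eval, eval, hρ.m_eq]
  have : m + ρ i < L := by
    have := hs.k_le; have := hs.m_le; have := hs.sq_le; omega
  rw [demE, eval_digE hs hρ hp (by simpa [eval] using ha.le) (by rwa [h]), h, eval]

theorem n_le (hs : Sizes n k m L B) : n ≤ L := by
  have := hs.n_lt; have := hs.sq_le; omega

theorem eval_srcE (hs : Sizes n k m L B) (hρ : Setup n k m c L B ρ) (e : Expr) :
    (srcE e).eval L μ ρ = μ (n * n + 2 * e.eval L μ ρ) := by
  rw [srcE, eval, eval, eval_mul (by rw [eval, hρ.n_eq]; exact n_le hs), eval, eval, hρ.n_eq,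
    two_mul]

theorem eval_tgtE (hs : Sizes n k m L B) (hρ : Setup n k m c L B ρ) (e : Expr) :
    (tgtE e).eval L μ ρ = μ (n * n + (2 * e.eval L μ ρ + 1)) := by
  rw [tgtE, eval, eval, eval_mul (by rw [eval, hρ.n_eq]; exact n_le hs), eval, eval, eval, eval,
    hρ.n_eq, two_mul]

theorem holds_reachE (hρ : Setup n k m c L B ρ) {u v : Expr} (hu : u.eval L μ ρ ≤ L) :
    (reachE u v).Holds L μ ρ ↔ μ (2 * L + (u.eval L μ ρ * n + v.eval L μ ρ)) ≠ 0 := by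
  rw [reachE, holds_load, eval, eval_pairE hρ hu, eval, eval, hρ.L_eq, two_mul]

theorem eval_tableE (hρ : Setup n k m c L B ρ) : tableE.eval L μ ρ = 3 * L := by
  simp only [tableE, eval, hρ.L_eq]
  omega

theorem holds_closureE (hs : Sizes n k m L B) (hρ : Setup n k m c L B ρ) (hx : ρ 7 < L) :
    closureE.Holds L μ ρ ↔ ρ 7 < n * n ∧ (μ (ρ 7) ≠ 0 ∨
      ∃ w < n, μ (ρ 7 / n * n + w) ≠ 0 ∧ μ (2 * L + (w * n + ρ 7 % n)) ≠ 0) := by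
  have hn := n_le hs
  have hnn : (Expr.mul (.var 0) (.var 0)).eval L μ ρ = n * n := by
    rw [eval_mul (by rwa [eval, hρ.n_eq]), eval, hρ.n_eq]
  rw [closureE, holds_and, holds_lt, hnn, eval]
  refine and_congr_right fun h7 => ?_
  have hn0 : 0 < n := Nat.pos_of_mul_pos_left (Nat.zero_lt_of_lt h7)
  rw [holds_or, holds_load, eval, holds_sum]
  refine or_congr Iff.rfl ⟨fun ⟨w, hw, h⟩ => ⟨w, ?_⟩, fun ⟨w, hw, h⟩ => ⟨w, by omega, ?_⟩⟩
  all_goals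
    have hρ' := hρ.update (x := 8) (by omega) w
    set ρ' := Function.update ρ 8 w with hρ'_def
    have h7' : ρ' 7 = ρ 7 := by simp [hρ'_def]
    have h8' : ρ' 8 = w := by simp [hρ'_def]
    have hd : (Expr.div (.var 7) (.var 0)).eval L μ ρ' = ρ 7 / n := by
      rw [eval_div (by rw [eval, h7']; omega) (by rwa [eval, hρ'.n_eq]), eval, eval, h7', hρ'.n_eq]
    have hm : ((Expr.var 7).mod (.var 0)).eval L μ ρ' = ρ 7 % n := by
      rw [eval_mod (by rw [eval, h7']; omega) (by rwa [eval, hρ'.n_eq])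
        (by rwa [eval, hρ'.n_eq]), eval, eval, h7', hρ'.n_eq]
    have hdL : ρ 7 / n ≤ L := (Nat.div_le_self _ _).trans hx.le
  · rw [holds_and, holds_lt, holds_and, holds_load, eval_pairE hρ' (by rwa [hd]), hd,
      holds_reachE hρ' (by rw [eval, h8']; omega), hm, eval, eval, h8', hρ'.n_eq] at h
    exact h
  · rw [holds_and, holds_lt, holds_and, holds_load, eval_pairE hρ' (by rwa [hd]), hd,
      holds_reachE hρ' (by rw [eval, h8']; omega), hm, eval, eval, h8', hρ'.n_eq]
    exact ⟨hw, h⟩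

theorem holds_doneE (hs : Sizes n k m L B) (hρ : Setup n k m c L B ρ)
    (hp : ∀ j < L, μ (L + j) = B ^ j) (hx : ρ 7 < L) :
    doneE.Holds L μ ρ ↔ ∀ i < m, ¬ dig B (ρ 7) i < n := by
  have hmL : m ≤ L := by have := hs.k_le; have := hs.m_le; have := hs.sq_le; omega
  have key : ∀ i < L, ((Expr.imp (.lt (.var 10) (.var 3)) (.not (.lt (posE 7 10) (.var 0)))).Holds
      L μ (Function.update ρ 10 i) ↔ (i < m → ¬ dig B (ρ 7) i < n)) := by
    intro i hi
    have hρ' := hρ.update (x := 10) (by omega) i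
    rw [holds_imp, holds_lt, holds_not, holds_lt,
      eval_posE hs hρ' hp (by simpa using hx) (by simpa using hi), eval, eval, eval, hρ'.m_eq,
      hρ'.n_eq]
    simp
  rw [doneE, holds_all]
  exact ⟨fun h i hi => (key i (by omega)).1 (h i (by omega)) hi,
    fun h i hi => (key i hi).2 (h i)⟩

/-- The arithmetical meaning of `moveE`. -/
def ArithMoves (n m c L B : ℕ) (μ : ℕ → ℕ) (a b j : ℕ) : Prop :=
  dig B a j < n ∧
  (∀ i < m, (dig B a i < n → μ (2 * L + (dig B a i * n + dig B a j)) = 0) ∧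
    (i ≠ j → dig B b i = dig B a i) ∧ dig B b (m + i) = dig B a (m + i)) ∧
  ((Finset.range m).filter fun i => dig B a i = dig B a j).card ≤ c ∧
  ((dig B b j < n ∧ μ (dig B a j * n + dig B b j) ≠ 0) ∨
    (¬ dig B b j < n ∧ μ (n * n + (2 * dig B a (m + j) + 1)) = dig B a j))

theorem holds_moveE (hs : Sizes n k m L B) (hρ : Setup n k m c L B ρ)
    (hp : ∀ j < L, μ (L + j) = B ^ j) (h7 : ρ 7 < L) (h8 : ρ 8 < L) (h9 : ρ 9 < m) :
    moveE.Holds L μ ρ ↔ ArithMoves n m c L B μ (ρ 7) (ρ 8) (ρ 9) := by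
  have hB : 0 < B := by have := hs.n_lt; omega
  have hBL : B ≤ L := by have := hs.sq_le; omega
  have hmL : m ≤ L := by have := hs.k_le; have := hs.m_le; have := hs.sq_le; omega
  have h9' : ρ 9 < L := by omega
  have e79 := eval_posE hs hρ hp h7 h9'
  have e89 := eval_posE hs hρ hp h8 h9'
  have d79 := eval_demE hs hρ hp h7 h9
  have l79 : (posE 7 9).eval L μ ρ ≤ L := by rw [e79]; exact (dig_lt hB _ _).le.trans hBL
  rw [moveE, holds_and, holds_and, holds_and, holds_or, holds_and, holds_and, holds_lt, holds_lt,
    holds_not, holds_not, holds_lt, holds_lt, holds_eq, holds_load, eval_tgtE hs hρ,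
    eval_pairE hρ l79, e79, e89, d79, holds_all]
  have hn0 : (Expr.var 0).eval L μ ρ = n := hρ.n_eq
  have hc4 : (Expr.var 4).eval L μ ρ = c := hρ.c_eq
  rw [hn0, hc4, ArithMoves]
  refine and_congr_right fun _ => and_congr ?_ (and_congr ?_ Iff.rfl)
  · have key : ∀ i < L, ((Expr.imp (.lt (.var 10) (.var 3)) <|
        (Expr.imp (.lt (posE 7 10) (.var 0)) (.not (reachE (posE 7 10) (posE 7 9)))).and <|
        (Expr.imp (.not (.eq (.var 10) (.var 9))) (.eq (posE 8 10) (posE 7 10))).and <|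
          .eq (demE 8 10) (demE 7 10)).Holds L μ (Function.update ρ 10 i) ↔ (i < m →
          (dig B (ρ 7) i < n → μ (2 * L + (dig B (ρ 7) i * n + dig B (ρ 7) (ρ 9))) = 0) ∧
          (i ≠ ρ 9 → dig B (ρ 8) i = dig B (ρ 7) i) ∧
          dig B (ρ 8) (m + i) = dig B (ρ 7) (m + i))) := by
      intro i hi
      have hρ' := hρ.update (x := 10) (by omega) i
      set ρ' := Function.update ρ 10 i with hρ'_def
      have g7 : ρ' 7 = ρ 7 := by simp [hρ'_def]
      have g8 : ρ' 8 = ρ 8 := by simp [hρ'_def]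
      have g9 : ρ' 9 = ρ 9 := by simp [hρ'_def]
      have g10 : ρ' 10 = i := by simp [hρ'_def]
      have v3 : (Expr.var 3).eval L μ ρ' = m := hρ'.m_eq
      have v0 : (Expr.var 0).eval L μ ρ' = n := hρ'.n_eq
      have v9 : (Expr.var 9).eval L μ ρ' = ρ 9 := g9
      have v10 : (Expr.var 10).eval L μ ρ' = i := g10
      rw [holds_imp, holds_lt, v10, v3]
      refine forall_congr' fun him => ?_
      have p7 := eval_posE hs hρ' hp (a := 7) (i := 10) (by omega) (by omega)
      have p8 := eval_posE hs hρ' hp (a := 8) (i := 10) (by omega) (by omega)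
      have p9 := eval_posE hs hρ' hp (a := 7) (i := 9) (by omega) (by omega)
      have q7 := eval_demE hs hρ' hp (a := 7) (i := 10) (by omega) (by omega)
      have q8 := eval_demE hs hρ' hp (a := 8) (i := 10) (by omega) (by omega)
      rw [g7, g10] at p7 q7
      rw [g8, g10] at p8 q8
      rw [g7, g9] at p9
      have l7 : (posE 7 10).eval L μ ρ' ≤ L := by rw [p7]; exact (dig_lt hB _ _).le.trans hBL
      rw [holds_and, holds_and, holds_imp, holds_imp, holds_lt, holds_not, holds_not, holds_eq,
        holds_eq, holds_eq, holds_reachE hρ' l7, p7, p8, p9, q7, q8, v0, v9, v10, not_not]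
    exact ⟨fun h i hi => (key i (by omega)).1 (h i (by omega)) hi,
      fun h i hi => (key i hi).2 (h i)⟩
  · rw [not_lt, eval]
    -- The summation variable runs up to `L`, not `m`; the guard makes the superfluous terms vanish.
    have : ∀ i ∈ Finset.range L, ((Expr.lt (.var 10) (.var 3)).and
        (.eq (posE 7 10) (posE 7 9))).eval L μ (Function.update ρ 10 i) =
        if i < m ∧ dig B (ρ 7) i = dig B (ρ 7) (ρ 9) then 1 else 0 := by
      intro i hi
      rw [Finset.mem_range] at hi
      have hρ' := hρ.update (x := 10) (by omega) i
      have hlt := holds_lt L μ (Function.update ρ 10 i) (.var 10) (.var 3)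
      rw [show (Expr.var 3).eval L μ (Function.update ρ 10 i) = m from hρ'.m_eq,
        show (Expr.var 10).eval L μ (Function.update ρ 10 i) = i by simp [eval], Holds] at hlt
      rw [eval_and, RAM.Expr.eval_eq, eval_posE hs hρ' hp (by simpa using h7) (by simpa using hi),
        eval_posE hs hρ' hp (by simpa using h7) (by simpa using h9')]
      simp only [hlt]
      by_cases him : i < m <;> simp [him]
    rw [Finset.sum_congr rfl this, ← Finset.card_filter]
    refine Eq.to_iff (congrArg (· ≤ c) (congrArg Finset.card ?_))
    ext i
    simp only [Finset.mem_filter, Finset.mem_range]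
    constructor
    · exact fun h => ⟨h.2.1, h.2.2⟩
    · exact fun h => ⟨by omega, h⟩

theorem holds_configE (hs : Sizes n k m L B) (hρ : Setup n k m c L B ρ)
    (hp : ∀ j < L, μ (L + j) = B ^ j) (h7 : ρ 7 < L) :
    configE.Holds L μ ρ ↔ (∀ i < m, ¬ dig B (ρ 7) i < n) ∨
      ∃ b < L, μ (3 * L + b) ≠ 0 ∧ ∃ j < m, ArithMoves n m c L B μ (ρ 7) b j := by
  have hmL : m ≤ L := by have := hs.k_le; have := hs.m_le; have := hs.sq_le; omega
  rw [configE, holds_or, holds_doneE hs hρ hp h7, holds_sum]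
  refine or_congr Iff.rfl (exists_congr fun b => and_congr_right fun hb => ?_)
  have hρ' := hρ.update (x := 8) (by omega) b
  rw [holds_and, holds_load, eval, eval_tableE hρ', holds_sum]
  refine and_congr (by simp [eval]) ⟨?_, ?_⟩
  · rintro ⟨j, hj, h⟩
    have hρ'' := hρ'.update (x := 9) (by omega) j
    rw [holds_and, holds_lt, eval, eval, hρ''.m_eq, Function.update_self] at h
    refine ⟨j, h.1, ?_⟩
    have := (holds_moveE hs hρ'' hp (by simpa using h7) (by simpa using hb)
      (by simpa using h.1)).1 h.2
    simpa using this
  · rintro ⟨j, hj, h⟩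
    have hρ'' := hρ'.update (x := 9) (by omega) j
    refine ⟨j, by omega, ?_⟩
    rw [holds_and, holds_lt, eval, eval, hρ''.m_eq, Function.update_self]
    refine ⟨hj, (holds_moveE hs hρ'' hp (by simpa using h7) (by simpa using hb)
      (by simpa using hj)).2 ?_⟩
    simpa using h

/-- The arithmetical meaning of `startE`. -/
def ArithStart (n k m B : ℕ) (μ : ℕ → ℕ) (a : ℕ) : Prop :=
  ∀ i < m, dig B a (m + i) < k ∧ μ (n * n + 2 * dig B a (m + i)) = dig B a i ∧
    ∀ j < i, dig B a (m + j) ≠ dig B a (m + i)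

theorem holds_startE (hs : Sizes n k m L B) (hρ : Setup n k m c L B ρ)
    (hp : ∀ j < L, μ (L + j) = B ^ j) (h7 : ρ 7 < L) :
    startE.Holds L μ ρ ↔ ArithStart n k m B μ (ρ 7) := by
  have hmL : m ≤ L := by have := hs.k_le; have := hs.m_le; have := hs.sq_le; omega
  have key : ∀ i < L, ((Expr.imp (.lt (.var 10) (.var 3)) <|
    (Expr.lt (demE 7 10) (.var 1)).and <| (Expr.eq (srcE (demE 7 10)) (posE 7 10)).and <|
      .all (.imp (.lt (.var 11) (.var 10)) (.not (.eq (demE 7 11) (demE 7 10)))) 11).Holds L μ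
        (Function.update ρ 10 i) ↔ (i < m → dig B (ρ 7) (m + i) < k ∧
          μ (n * n + 2 * dig B (ρ 7) (m + i)) = dig B (ρ 7) i ∧
          ∀ j < i, dig B (ρ 7) (m + j) ≠ dig B (ρ 7) (m + i))) := by
    intro i hi
    have hρ' := hρ.update (x := 10) (by omega) i
    set ρ' := Function.update ρ 10 i with hρ'_def
    have g7 : ρ' 7 = ρ 7 := by simp [hρ'_def]
    have g10 : ρ' 10 = i := by simp [hρ'_def]
    rw [holds_imp, holds_lt, eval, eval, hρ'.m_eq, g10]
    refine forall_congr' fun him => ?_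
    have p7 := eval_posE hs hρ' hp (a := 7) (i := 10) (by omega) (by omega)
    have q7 := eval_demE hs hρ' hp (a := 7) (i := 10) (by omega) (by omega)
    rw [g7, g10] at p7 q7
    rw [holds_and, holds_and, holds_lt, holds_eq, eval_srcE hs hρ', p7, q7, eval, hρ'.k_eq,
      holds_all]
    refine and_congr_right fun _ => and_congr_right fun _ => ?_
    have key' : ∀ j < L, ((Expr.imp (.lt (.var 11) (.var 10))
        (.not (.eq (demE 7 11) (demE 7 10)))).Holds L μ (Function.update ρ' 11 j) ↔
        (j < i → dig B (ρ 7) (m + j) ≠ dig B (ρ 7) (m + i))) := by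
      intro j hj
      have hρ'' := hρ'.update (x := 11) (by omega) j
      set ρ'' := Function.update ρ' 11 j with hρ''_def
      have f7 : ρ'' 7 = ρ 7 := by simp [hρ''_def, g7]
      have f10 : ρ'' 10 = i := by simp [hρ''_def, g10]
      have f11 : ρ'' 11 = j := by simp [hρ''_def]
      rw [holds_imp, holds_lt, eval, eval, f10, f11]
      refine forall_congr' fun hji => ?_
      have q10 := eval_demE hs hρ'' hp (a := 7) (i := 10) (by omega) (by omega)
      have q11 := eval_demE hs hρ'' hp (a := 7) (i := 11) (by omega) (by omega)
      rw [f7, f10] at q10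
      rw [f7, f11] at q11
      rw [holds_not, holds_eq, q10, q11]
    exact ⟨fun h j hj => (key' j (by omega)).1 (h j (by omega)) hj,
      fun h j hj => (key' j hj).2 (h j)⟩
  rw [startE, holds_all]
  exact ⟨fun h i hi => (key i (by omega)).1 (h i (by omega)) hi,
    fun h i hi => (key i hi).2 (h i)⟩

/-- Sources must not exceed the limit because the index of a pair is computed with a truncated
product. -/
theorem holds_linkedE (hs : Sizes n k m L B) (hρ : Setup n k m c L B ρ)
    (hsrc : ∀ i < k, μ (n * n + 2 * i) ≤ L) :
    linkedE.Holds L μ ρ ↔ ∀ i < k, μ (n * n + 2 * i) = μ (n * n + (2 * i + 1)) ∨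
      μ (2 * L + (μ (n * n + 2 * i) * n + μ (n * n + (2 * i + 1)))) ≠ 0 := by
  have hkL : k ≤ L := by have := hs.k_le; have := hs.sq_le; omega
  have key : ∀ i < L, ((Expr.imp (.lt (.var 10) (.var 1)) <|
    (Expr.eq (srcE (.var 10)) (tgtE (.var 10))).or
      (reachE (srcE (.var 10)) (tgtE (.var 10)))).Holds L μ (Function.update ρ 10 i) ↔
      (i < k → μ (n * n + 2 * i) = μ (n * n + (2 * i + 1)) ∨
      μ (2 * L + (μ (n * n + 2 * i) * n + μ (n * n + (2 * i + 1)))) ≠ 0)) := by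
    intro i hi
    have hρ' := hρ.update (x := 10) (by omega) i
    have h10 : (Expr.var 10).eval L μ (Function.update ρ 10 i) = i := by simp [eval]
    have hs10 := eval_srcE (μ := μ) hs hρ' (.var 10)
    have ht10 := eval_tgtE (μ := μ) hs hρ' (.var 10)
    rw [h10] at hs10 ht10
    rw [holds_imp, holds_lt, h10, eval, hρ'.k_eq]
    refine forall_congr' fun hik => ?_
    rw [holds_or, holds_eq, holds_reachE hρ' (by rw [hs10]; exact hsrc i hik), hs10, ht10]
  rw [linkedE, holds_all]
  exact ⟨fun h i hi => (key i (by omega)).1 (h i (by omega)) hi,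
    fun h i hi => (key i hi).2 (h i)⟩

theorem eval_answerE [Decidable (linkedE.Holds L μ ρ ∧
      ∃ a < L, startE.Holds L μ (Function.update ρ 7 a) ∧ μ (3 * L + a) ≠ 0)]
    (hρ : Setup n k m c L B ρ) :
    answerE.eval L μ ρ = if linkedE.Holds L μ ρ ∧
      ∃ a < L, startE.Holds L μ (Function.update ρ 7 a) ∧ μ (3 * L + a) ≠ 0 then 1 else 0 := by
  have h : (linkedE.and (.sum 7 (startE.and (.load (.add tableE (.var 7)))))).Holds L μ ρ ↔
      linkedE.Holds L μ ρ ∧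
      ∃ a < L, startE.Holds L μ (Function.update ρ 7 a) ∧ μ (3 * L + a) ≠ 0 := by
    rw [holds_and, holds_sum]
    refine and_congr_right fun _ => exists_congr fun a => and_congr_right fun _ => ?_
    rw [holds_and, holds_load, eval, eval_tableE (hρ.update (by omega) a), eval,
      Function.update_self]
  rw [answerE, eval]
  exact if_congr h rfl rfl

end eval

end CongestionRouting

namespace CongestionRouting

open RAM RAM.Expr

/-! ### Correctness of the tables -/

/-- There is a walk of at least one and at most `r` edges. -/
def ReachIn {V : Type*} (G : Digraph V) : ℕ → V → V → Prop
  | 0, _, _ => False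
  | r + 1, u, v => G.Adj u v ∨ ∃ w, G.Adj u w ∧ ReachIn G r w v

theorem ReachIn.succ {V : Type*} {G : Digraph V} {r : ℕ} {u v : V} (h : ReachIn G r u v) :
    ReachIn G (r + 1) u v := by
  induction r generalizing u with
  | zero => exact h.elim
  | succ r ih =>
    rcases h with h | ⟨w, huw, h⟩
    · exact .inl h
    · exact .inr ⟨w, huw, ih h⟩

theorem ReachIn.mono {V : Type*} {G : Digraph V} {r s : ℕ} (hrs : r ≤ s) {u v : V}
    (h : ReachIn G r u v) : ReachIn G s u v := by
  induction hrs with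
  | refl => exact h
  | step _ ih => exact ih.succ

theorem reachIn_of_isChain {V : Type*} {G : Digraph V} {l : List V} {u v w : V}
    (hl : (u :: w :: l).IsChain G.Adj) (hv : (u :: w :: l).getLast? = some v) :
    ReachIn G (l.length + 1) u v := by
  induction l generalizing u w with
  | nil =>
    simp only [List.getLast?_cons_cons, List.getLast?_singleton, Option.some.injEq] at hv
    exact .inl (hv ▸ (List.isChain_cons_cons.1 hl).1)
  | cons x l ih =>
    obtain ⟨h1, h2⟩ := List.isChain_cons_cons.1 hl
    rw [List.getLast?_cons_cons] at hv
    exact .inr ⟨w, h1, ih h2 hv⟩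

/-- Reachability is witnessed by a path without repeated vertices, so its length is bounded by the
number of vertices. -/
theorem IsAcyclic.reachIn_of_transGen {V : Type*} [Fintype V] {G : Digraph V} (hG : IsAcyclic G)
    {u v : V} (h : Relation.TransGen G.Adj u v) : ReachIn G (Fintype.card V) u v := by
  obtain ⟨P, hn, hc, hh, hl⟩ := (exists_links_iff hG).2 (.inr h)
  have hlen := hn.length_le_card
  obtain ⟨l, rfl⟩ := List.head?_eq_some_iff.1 hh
  cases l with
  | nil =>
    simp only [List.getLast?_singleton, Option.some.injEq] at hl
    exact (hG v (hl ▸ h)).elim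
  | cons w l =>
    refine (reachIn_of_isChain hc hl).mono ?_
    simp only [List.length_cons] at hlen
    omega

theorem pair_lt {n : ℕ} (u v : Fin n) : (u : ℕ) * n + v < n * n := by
  have h1 : ((u : ℕ) + 1) * n ≤ n * n := Nat.mul_le_mul_right _ u.2
  rw [Nat.add_mul] at h1
  have := v.2
  omega

theorem pair_div {n : ℕ} (u v : Fin n) : ((u : ℕ) * n + v) / n = u := by
  have := v.2
  rw [mul_comm, Nat.mul_add_div (by omega), Nat.div_eq_of_lt v.2, add_zero]

theorem pair_mod {n : ℕ} (u v : Fin n) : ((u : ℕ) * n + v) % n = v := by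
  rw [mul_comm, Nat.mul_add_mod, Nat.mod_eq_of_lt v.2]

theorem exists_pair {n x : ℕ} (hx : x < n * n) : ∃ u v : Fin n, x = (u : ℕ) * n + v := by
  have hn : 0 < n := Nat.pos_of_mul_pos_left (Nat.zero_lt_of_lt hx)
  exact ⟨⟨x / n, Nat.div_lt_of_lt_mul hx⟩, ⟨x % n, Nat.mod_lt _ hn⟩, (Nat.div_add_mod' x n).symm⟩

/-- The memory holds the adjacency matrix. -/
def HoldsAdj {n : ℕ} (G : Digraph (Fin n)) (μ : ℕ → ℕ) : Prop :=
  ∀ u v : Fin n, μ (u * n + v) ≠ 0 ↔ G.Adj u v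

/-- The memory holds the transitive closure. -/
def HoldsReach {n : ℕ} (G : Digraph (Fin n)) (L : ℕ) (μ : ℕ → ℕ) : Prop :=
  ∀ u v : Fin n, μ (2 * L + (u * n + v)) ≠ 0 ↔ Relation.TransGen G.Adj u v

/-- An instance of `iterate_pass_spec` with the walk length as rank; `n ≤ L` passes already suffice.
-/
theorem closure_correct {n k m c L B : ℕ} (hs : Sizes n k m L B) {G : Digraph (Fin n)}
    (hG : IsAcyclic G) {ρ μ₀ : ℕ → ℕ} (hρ : Setup n k m c L B ρ) (hadj : HoldsAdj G μ₀)
    (hz : ∀ b < L, μ₀ (2 * L + b) = 0) :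
    HoldsReach G L ((pass (2 * L) (fun i μ => closureE.eval L μ (Function.update ρ 7 i)) L)^[L]
      μ₀) := by
  have hnn : n * n ≤ L := by
    have := Nat.mul_le_mul hs.n_lt.le hs.n_lt.le
    have := hs.sq_le
    omega
  have hpair : ∀ u v : Fin n, (u : ℕ) * n + v < L := fun u v => (pair_lt u v).trans_le hnn
  have htest : ∀ μ : ℕ → ℕ, (∀ a, a < 2 * L ∨ 2 * L + L ≤ a → μ a = μ₀ a) → ∀ u v : Fin n,
      closureE.eval L μ (Function.update ρ 7 (u * n + v)) ≠ 0 ↔ G.Adj u v ∨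
        ∃ w : Fin n, G.Adj u w ∧ μ (2 * L + (w * n + v)) ≠ 0 := by
    intro μ hμ u v
    have h := holds_closureE (μ := μ) hs (hρ.update (x := 7) (by omega) (u * n + v))
      (by simpa using hpair u v)
    rw [Function.update_self, pair_div, pair_mod] at h
    refine h.trans ?_
    have hadj' : HoldsAdj G μ := fun u v => by
      rw [hμ _ (.inl (by have := hpair u v; omega)), hadj u v]
    rw [and_iff_right (pair_lt u v), hadj' u v]
    refine or_congr Iff.rfl ⟨?_, ?_⟩
    · rintro ⟨w, hw, h1, h2⟩
      exact ⟨⟨w, hw⟩, (hadj' u ⟨w, hw⟩).1 h1, h2⟩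
    · rintro ⟨w, h1, h2⟩
      exact ⟨w, w.2, (hadj' u w).2 h1, h2⟩
  have hfun : ∀ {u v u' v' : Fin n}, (u : ℕ) * n + v = u' * n + v' → u = u' ∧ v = v' := by
    intro u v u' v' h
    refine ⟨Fin.ext ?_, Fin.ext ?_⟩
    · rw [← pair_div u v, h, pair_div]
    · rw [← pair_mod u v, h, pair_mod]
  have := iterate_pass_spec (base := 2 * L) (L := L) (μ₀ := μ₀)
    (f := fun i μ => closureE.eval L μ (Function.update ρ 7 i))
    (Sound := fun x => ∃ u v : Fin n, x = (u : ℕ) * n + v ∧ Relation.TransGen G.Adj u v)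
    (Rank := fun r x => ∃ u v : Fin n, x = (u : ℕ) * n + v ∧ ReachIn G r u v)
    (fun x ⟨_, _, _, h⟩ => h) (fun r x ⟨u, v, hx, h⟩ => ⟨u, v, hx, h.succ⟩) hz
    (by
      intro μ hμ x hx hS hf
      have hxn : x < n * n := by
        have h := (holds_closureE (μ := μ) hs (hρ.update (x := 7) (by omega) x)
          (by simpa using hx)).1 hf
        simpa using h.1
      obtain ⟨u, v, rfl⟩ := exists_pair hxn
      refine ⟨u, v, rfl, ?_⟩
      rcases (htest μ hμ u v).1 hf with h | ⟨w, huw, hw⟩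
      · exact .single h
      · obtain ⟨u', v', he, h⟩ := hS _ (hpair w v) hw
        obtain ⟨rfl, rfl⟩ := hfun he
        exact .head huw h)
    (by
      rintro μ hμ x hx r hR ⟨u, v, rfl, h⟩
      refine (htest μ hμ u v).2 ?_
      rcases h with h | ⟨w, huw, h⟩
      · exact .inl h
      · exact .inr ⟨w, huw, hR _ (hpair w v) ⟨w, v, rfl, h⟩⟩) L
  intro u v
  obtain ⟨h1, h2⟩ := this _ (hpair u v)
  refine ⟨fun h => ?_, fun h => h2 ⟨u, v, rfl, ?_⟩⟩
  · obtain ⟨u', v', he, h⟩ := h1 h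
    obtain ⟨rfl, rfl⟩ := hfun he
    exact h
  · refine (hG.reachIn_of_transGen h).mono ?_
    rw [Fintype.card_fin]
    exact n_le hs

/-- The configuration with code `a`. -/
def config (n m B a : ℕ) (i : Fin m) : Option (Fin n) :=
  if h : dig B a i < n then some ⟨dig B a i, h⟩ else none

theorem config_eq_some {n m B a : ℕ} {i : Fin m} {v : Fin n} :
    config n m B a i = some v ↔ dig B a i = v := by
  unfold config
  split_ifs with h
  · simp [Fin.ext_iff]
  · have := v.2
    simp only [false_iff]
    omega

theorem config_eq_none {n m B a : ℕ} {i : Fin m} :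
    config n m B a i = none ↔ ¬ dig B a i < n := by
  unfold config
  split_ifs with h <;> simp [h]

/-- The targets of the pebbles in the configuration with code `a`. -/
def IsTarget (n m B : ℕ) (μ : ℕ → ℕ) (a : ℕ) (i : Fin m) (v : Fin n) : Prop :=
  μ (n * n + (2 * dig B a (m + i) + 1)) = v

theorem ncard_dig_eq (m B a x : ℕ) : {i : Fin m | dig B a i = x}.ncard =
    ((Finset.range m).filter fun i => dig B a i = x).card := by
  have : {i : Fin m | dig B a i = x} =
      (Finset.univ.filter fun i : Fin m => dig B a i = x : Finset (Fin m)) := by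
    ext; simp
  rw [this, Set.ncard_coe_finset, Finset.card_filter, Finset.card_filter, Finset.sum_range]

/-- The demand digits do not change in a move, so both codes have the same targets. -/
theorem ArithMoves.moves {n m c L B : ℕ} {G : Digraph (Fin n)} {μ : ℕ → ℕ}
    (hadj : HoldsAdj G μ) (hreach : HoldsReach G L μ) {a b j : ℕ} (hj : j < m)
    (h : ArithMoves n m c L B μ a b j) :
    IsTarget n m B μ b = IsTarget n m B μ a ∧
      Moves G c (IsTarget n m B μ a) (config n m B a) (config n m B b) := by
  obtain ⟨h1, h2, h3, h4⟩ := h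
  refine ⟨?_, ⟨j, hj⟩, ⟨dig B a j, h1⟩, config_eq_some.2 rfl, fun i u hu => ?_, ?_,
    fun i hi => ?_, ?_⟩
  · funext i v
    rw [IsTarget, IsTarget, (h2 i i.2).2.2]
  · rw [config_eq_some] at hu
    rw [← hreach u, not_not]
    have := (h2 i i.2).1 (by rw [hu]; exact u.2)
    rwa [hu] at this
  · simp only [config_eq_some]
    rwa [ncard_dig_eq]
  · unfold config
    simp only [(h2 i i.2).2.1 fun e => hi (Fin.ext e)]
  · rcases h4 with ⟨h4, h5⟩ | ⟨h4, h5⟩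
    · exact .inl ⟨⟨dig B b j, h4⟩, config_eq_some.2 rfl, (hadj ⟨_, h1⟩ ⟨_, h4⟩).1 h5⟩
    · exact .inr ⟨config_eq_none.2 h4, h5⟩

theorem Moves.exists_arithMoves {n k m c L B : ℕ} (hs : Sizes n k m L B) {G : Digraph (Fin n)}
    {μ : ℕ → ℕ} (hadj : HoldsAdj G μ) (hreach : HoldsReach G L μ) {a : ℕ}
    {q : Fin m → Option (Fin n)} (h : Moves G c (IsTarget n m B μ a) (config n m B a) q) :
    ∃ b < L, ∃ j < m, ArithMoves n m c L B μ a b j ∧ config n m B b = q := by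
  obtain ⟨j, v, hv, hr, hc, hne, hq⟩ := h
  have hB : 0 < B := by have := hs.n_lt; omega
  have hx : ∃ x < B, (if h : x < n then some (⟨x, h⟩ : Fin n) else none) = q j := by
    cases hqj : q j with
    -- The digit `n < B` stands for a pebble that has left.
    | none => exact ⟨n, hs.n_lt, by simp⟩
    | some w => exact ⟨w, w.2.trans hs.n_lt, by simp⟩
  obtain ⟨x, hxB, hxq⟩ := hx
  obtain ⟨b, hb, hdig⟩ := exists_dig_eq (B := B) (2 * m)
    (fun i => if i = j then x else dig B a i) fun i _ => by
      split_ifs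
      · exact hxB
      · exact dig_lt hB _ _
  have hbq : config n m B b = q := by
    funext i
    have h := hdig i (by omega)
    by_cases hij : i = j
    · subst hij
      rw [if_pos rfl] at h
      unfold config
      rw [← hxq]
      simp only [h]
    · rw [if_neg fun e => hij (Fin.ext e)] at h
      rw [hne i hij]
      unfold config
      simp only [h]
  rw [config_eq_some] at hv
  simp only [config_eq_some, ncard_dig_eq] at hc
  refine ⟨b, hb.trans_le hs.pow_le, j, j.2, ⟨by rw [hv]; exact v.2, fun i hi =>
    ⟨fun hu => ?_, fun hij => ?_, ?_⟩, by rwa [hv], ?_⟩, hbq⟩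
  · have := hr ⟨i, hi⟩ ⟨dig B a i, hu⟩ (config_eq_some.2 rfl)
    rw [← hreach, not_not] at this
    rwa [hv]
  · rw [hdig i (by omega), if_neg hij]
  · rw [hdig (m + i) (by omega), if_neg (by omega)]
  · rcases hq with ⟨w, hw, hvw⟩ | ⟨hw, ht⟩
    · rw [← hbq, config_eq_some] at hw
      rw [hw, hv]
      exact .inl ⟨w.2, (hadj v w).2 hvw⟩
    · rw [← hbq, config_eq_none] at hw
      exact .inr ⟨hw, by rw [hv]; exact ht⟩

/-- The rank is governed by the total length of the lists: a move backwards preserves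
completability, and a move forwards shortens the total by one. This length is at most `m * n < L`,
so `L` passes suffice. -/
theorem configs_correct {n k m c L B : ℕ} (hs : Sizes n k m L B) {G : Digraph (Fin n)}
    (hG : IsAcyclic G) {ρ μ₀ : ℕ → ℕ} (hρ : Setup n k m c L B ρ)
    (hp : ∀ j < L, μ₀ (L + j) = B ^ j) (hadj : HoldsAdj G μ₀) (hreach : HoldsReach G L μ₀)
    (hz : ∀ b < L, μ₀ (3 * L + b) = 0) : ∀ a < L,
    ((pass (3 * L) (fun i μ => configE.eval L μ (Function.update ρ 7 i)) L)^[L] μ₀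
      (3 * L + a) ≠ 0 ↔
      ∃ P, Completes G c (IsTarget n m B μ₀ a) (config n m B a) P) := by
  have hB : 0 < B := by have := hs.n_lt; omega
  have hnn : n * n ≤ B * B := Nat.mul_le_mul hs.n_lt.le hs.n_lt.le
  have hsq := hs.sq_le
  have hmn : m * n ≤ B * B := Nat.mul_le_mul (hs.m_le.trans hs.k_le) hs.n_lt.le
  -- Passes write only to the fourth block of `L` cells. Target addresses lie outside it even for
  -- digits that are not valid demands.
  have frame : ∀ μ : ℕ → ℕ, (∀ a, a < 3 * L ∨ 3 * L + L ≤ a → μ a = μ₀ a) →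
      (∀ j < L, μ (L + j) = B ^ j) ∧ HoldsAdj G μ ∧ HoldsReach G L μ ∧
      ∀ a, IsTarget n m B μ a = IsTarget n m B μ₀ a := by
    intro μ hμ
    refine ⟨fun j hj => by rw [hμ _ (.inl (by omega)), hp j hj], fun u v => ?_, fun u v => ?_,
      fun a => ?_⟩
    · have := pair_lt u v
      rw [hμ _ (.inl (by omega)), hadj u v]
    · have := pair_lt u v
      rw [hμ _ (.inl (by omega)), hreach u v]
    · funext i v
      have := dig_lt hB a (m + i)
      rw [IsTarget, IsTarget, hμ _ (.inl (by omega))]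
  have htest : ∀ μ : ℕ → ℕ, (∀ a, a < 3 * L ∨ 3 * L + L ≤ a → μ a = μ₀ a) → ∀ a < L,
      (configE.eval L μ (Function.update ρ 7 a) ≠ 0 ↔ (∀ i < m, ¬ dig B a i < n) ∨
      ∃ b < L, μ (3 * L + b) ≠ 0 ∧ ∃ j < m, ArithMoves n m c L B μ a b j) := by
    intro μ hμ a ha
    have := holds_configE hs (hρ.update (x := 7) (by omega) a) (frame μ hμ).1 (by simpa using ha)
    rwa [Function.update_self] at this
  have key := iterate_pass_spec (base := 3 * L) (L := L) (μ₀ := μ₀)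
    (f := fun i μ => configE.eval L μ (Function.update ρ 7 i))
    (Sound := fun a => ∃ P, Completes G c (IsTarget n m B μ₀ a) (config n m B a) P)
    (Rank := fun r a => ∃ P, Completes G c (IsTarget n m B μ₀ a) (config n m B a) P ∧
      ∑ i, (P i).length < r)
    (fun x ⟨_, _, h⟩ => by omega) (fun r x ⟨P, hP, h⟩ => ⟨P, hP, by omega⟩) hz
    (by
      intro μ hμ a ha hS hf
      obtain ⟨-, hadj', hreach', htar⟩ := frame μ hμ
      rcases (htest μ hμ a ha).1 hf with h | ⟨b, hb, hμb, j, hj, h⟩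
      · refine ⟨fun _ => [], fun i => ⟨?_, List.isChain_nil, by simp⟩, by simp⟩
        exact (config_eq_none.2 (h i i.2)).symm
      · obtain ⟨ht, hm⟩ := h.moves hadj' hreach' hj
        rw [htar, htar] at ht
        rw [htar] at hm
        obtain ⟨Q, hQ⟩ := hS b hb hμb
        rw [ht] at hQ
        exact hQ.of_moves hm)
    (by
      rintro μ hμ a ha r hR ⟨P, hP, hlen⟩
      obtain ⟨-, hadj', hreach', htar⟩ := frame μ hμ
      rw [htest μ hμ a ha]
      by_cases hd : ∃ i : Fin m, config n m B a i ≠ none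
      · obtain ⟨q, Q, hm, hQ, hQlen⟩ := hP.exists_moves hG hd
        rw [← htar] at hm
        obtain ⟨b, hb, j, hj, h, rfl⟩ := hm.exists_arithMoves hs hadj' hreach'
        refine .inr ⟨b, hb, hR b hb ⟨Q, ?_, by omega⟩, j, hj, h⟩
        have ht := (h.moves hadj' hreach' hj).1
        rw [htar, htar] at ht
        rwa [ht]
      · push Not at hd
        exact .inl fun i hi => config_eq_none.1 (hd ⟨i, hi⟩)) L
  intro a ha
  refine ⟨(key a ha).1, fun ⟨P, hP⟩ => (key a ha).2 ⟨P, hP, ?_⟩⟩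
  have := hP.sum_length_le hG
  rw [Fintype.card_fin] at this
  omega

/-! ### The input -/

/-- The memory holds the demands. -/
def HoldsDemands {n k : ℕ} (D : Fin k → Fin n × Fin n) (μ : ℕ → ℕ) : Prop :=
  ∀ i : Fin k, μ (n * n + 2 * i) = (D i).1 ∧ μ (n * n + (2 * i + 1)) = (D i).2

theorem holdsAdj_inputMem {n k : ℕ} (G : Digraph (Fin n)) (D : Fin k → Fin n × Fin n) :
    HoldsAdj G (inputMem G D) := by
  intro u v
  have h1 : ∀ h, (⟨((u : ℕ) * n + v) / n, h⟩ : Fin n) = u := fun _ => Fin.ext (pair_div u v)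
  have h2 : ∀ h, (⟨((u : ℕ) * n + v) % n, h⟩ : Fin n) = v := fun _ => Fin.ext (pair_mod u v)
  unfold inputMem
  rw [dif_pos (pair_lt u v), h1, h2]
  split_ifs with h <;> simp [h]

theorem holdsDemands_inputMem {n k : ℕ} (G : Digraph (Fin n)) (D : Fin k → Fin n × Fin n) :
    HoldsDemands D (inputMem G D) := by
  intro i
  have h1 : (n * n + 2 * (i : ℕ) - n * n) / 2 = i := by omega
  have h2 : (n * n + (2 * (i : ℕ) + 1) - n * n) / 2 = i := by omega
  have h3 : (n * n + 2 * (i : ℕ) - n * n) % 2 = 0 := by omega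
  have h4 : (n * n + (2 * (i : ℕ) + 1) - n * n) % 2 = 1 := by omega
  unfold inputMem
  constructor
  · rw [dif_neg (by omega), dif_pos (by rw [h1]; exact i.2), if_pos h3]
    simp only [h1]
  · rw [dif_neg (by omega), dif_pos (by rw [h2]; exact i.2), if_neg (by omega)]
    simp only [h2]

theorem inputMem_eq_zero {n k : ℕ} (G : Digraph (Fin n)) (D : Fin k → Fin n × Fin n) {a : ℕ}
    (ha : n * n + 2 * k ≤ a) : inputMem G D a = 0 := by
  unfold inputMem
  rw [dif_neg (by omega), dif_neg (by omega)]

/-! ### The answer -/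

/-- A starting code is an injective choice `e` of demands together with their sources: the upper
digits encode `e`, and the lower digits are determined by it. -/
theorem exists_start_iff {n k m c L B : ℕ} (hs : Sizes n k m L B) {G : Digraph (Fin n)}
    (hG : IsAcyclic G) {D : Fin k → Fin n × Fin n} {μ : ℕ → ℕ} (hD : HoldsDemands D μ) :
    (∃ a < L, ArithStart n k m B μ a ∧
      ∃ P, Completes G c (IsTarget n m B μ a) (config n m B a) P) ↔
    ∃ e : Fin m → Fin k, Function.Injective e ∧ HasRouting G c (D ∘ e) := by
  have trans : ∀ (a : ℕ) (e : Fin m → Fin k), (∀ i : Fin m, dig B a (m + i) = e i) →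
      (∀ i : Fin m, dig B a i = (D (e i)).1) →
      ((∃ P, Completes G c (IsTarget n m B μ a) (config n m B a) P) ↔
        HasRouting G c (D ∘ e)) := by
    intro a e he hpos
    rw [hasRouting_iff_exists_completes hG]
    have h1 : config n m B a = fun i => some ((D ∘ e) i).1 :=
      funext fun i => config_eq_some.2 (hpos i)
    have h2 : IsTarget n m B μ a = fun i x => x = ((D ∘ e) i).2 := by
      funext i x
      rw [IsTarget, he i, (hD (e i)).2, eq_iff_iff, eq_comm, Fin.ext_iff]
      rfl
    rw [h1, h2]
  constructor
  · rintro ⟨a, ha, hstart, hP⟩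
    let e : Fin m → Fin k := fun i => ⟨dig B a (m + i), (hstart i i.2).1⟩
    have hne : ∀ i j : Fin m, j < i → e j ≠ e i := fun i j hji h =>
      (hstart i i.2).2.2 j hji (congrArg Fin.val h)
    -- The start test compares only pairs `j < i`; trichotomy gives injectivity.
    refine ⟨e, fun i j hij => ?_, (trans a e (fun _ => rfl) fun i => ?_).1 hP⟩
    · rcases lt_trichotomy i j with h | h | h
      · exact absurd hij (hne _ _ h)
      · exact h
      · exact absurd hij.symm (hne _ _ h)
    · rw [← (hstart i i.2).2.1, ← (hD (e i)).1]
  · rintro ⟨e, he, hR⟩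
    obtain ⟨a, ha, hdig⟩ := exists_dig_eq (B := B) (2 * m)
      (fun i => if h : i < m then (D (e ⟨i, h⟩)).1 else
        if h' : i - m < m then e ⟨i - m, h'⟩ else 0) fun i hi => by
        split_ifs with h h'
        · exact (D _).1.2.trans hs.n_lt
        · exact (e _).2.trans_le hs.k_le
        · omega
    have hpos : ∀ i : Fin m, dig B a i = (D (e i)).1 := by
      intro i
      rw [hdig i (by omega), dif_pos i.2]
    have hdem : ∀ i : Fin m, dig B a (m + i) = e i := by
      intro i
      have h : ∀ h, (⟨m + i - m, h⟩ : Fin m) = i := fun _ => Fin.ext (Nat.add_sub_cancel_left ..)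
      rw [hdig (m + i) (by omega), dif_neg (by omega), dif_pos (by omega), h]
    refine ⟨a, ha.trans_le hs.pow_le, fun i hi => ⟨?_, ?_, fun j hj h => ?_⟩,
      (trans a e hdem hpos).2 hR⟩
    · rw [hdem ⟨i, hi⟩]
      exact (e _).2
    · rw [hdem ⟨i, hi⟩, (hD _).1, hpos ⟨i, hi⟩]
    · rw [hdem ⟨i, hi⟩, hdem ⟨j, by omega⟩] at h
      have := congrArg Fin.val (he (Fin.ext h))
      simp only at this
      omega

end CongestionRouting

/-! ### The main command and its correctness -/

namespace CongestionRouting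

open RAM RAM.Expr

/-- The entries of the table of the powers of `B`. -/
def powE : Expr :=
  .ite (.var 7) (.mul (.var 5) (.load (.sub (.add (.var 2) (.var 7)) (.const 1)))) (.const 1)

/-- The table is filled in increasing order, so the preceding power is present when it is read. -/
theorem powers_correct {L B : ℕ} (hB : B ≤ L) {ρ : ℕ → ℕ} (h2 : ρ 2 = L) (h5 : ρ 5 = B)
    (μ : ℕ → ℕ) : ∀ j < L,
    pass L (fun i μ => powE.eval L μ (Function.update ρ 7 i)) L μ (L + j) = B ^ j := by
  have hf : ∀ i μ, powE.eval L μ (Function.update ρ 7 i) =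
      if i = 0 then 1 else B * μ (L + i - 1) := by
    intro i μ
    simp [powE, eval, h2, h5, hB]
  have key : ∀ x, ∀ j < x,
      pass L (fun i μ => powE.eval L μ (Function.update ρ 7 i)) x μ (L + j) = B ^ j := by
    intro x
    induction x with
    | zero => exact fun j hj => absurd hj (by omega)
    | succ x ih =>
      intro j hj
      rw [RAM.pass]
      by_cases hjx : j = x
      · subst hjx
        rw [Function.update_self]
        refine (hf _ _).trans ?_
        cases j with
        | zero => simp
        | succ j =>
          rw [if_neg (by omega), ← add_assoc, Nat.add_sub_cancel, ih j (by omega), pow_succ']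
      · rw [Function.update_of_ne (by omega), ih j (by omega)]
  exact key L

/-- The sum of three copies of variable `12`. -/
def tripleE : Expr := .add (.add (.var 12) (.var 12)) (.var 12)

/-- The algorithm, apart from the computation of the limit. Variable `12` holds `d`. -/
def mainCmd : Cmd :=
  -- The truncated difference `3 * d - k` is nonzero exactly if `k < 3 * d`, so this is the minimum
  -- of the two.
  .seq (.assign 3 (.ite (.sub tripleE (.var 1)) (.var 1) tripleE)) <|
  .seq (.assign 4 (.sub (.var 3) (.var 12))) <|
  .seq (tabulate 7 (.var 2) powE) <|
  .seq (.loop 6 (tabulate 7 (.add (.var 2) (.var 2)) closureE)) <|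
  .seq (.loop 6 (tabulate 7 tableE configE)) <|
  .assign 0 answerE

open Classical in
theorem mainCmd_correct {n k d L B : ℕ} (hd : d < k) (hs : Sizes n k (min k (3 * d)) L B)
    {G : Digraph (Fin n)} (hG : IsAcyclic G) (D : Fin k → Fin n × Fin n) {ρ : ℕ → ℕ}
    (h0 : ρ 0 = n) (h1 : ρ 1 = k) (h2 : ρ 2 = L) (h5 : ρ 5 = B) (h12 : ρ 12 = d) :
    (mainCmd.eval L (ρ, inputMem G D)).1 0 = if HasRouting G (k - d) D then 1 else 0 := by
  set m := min k (3 * d) with hm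
  have hBL : B ≤ L := by have := hs.sq_le; omega
  have hnn : n * n ≤ B * B := Nat.mul_le_mul hs.n_lt.le hs.n_lt.le
  have hsq := hs.sq_le
  have hkB := hs.k_le
  have hin : n * n + 2 * k ≤ L := by omega
  set ρ₁ := Function.update (Function.update ρ 3 m) 4 (m - d) with hρ₁
  have hsetup : Setup n k m (m - d) L B ρ₁ := by
    constructor <;> simp [hρ₁, h0, h1, h2, h5]
  have e1 : (Cmd.assign 3 (.ite (.sub tripleE (.var 1)) (.var 1) tripleE)).eval L
      (ρ, inputMem G D) = (Function.update ρ 3 m, inputMem G D) := by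
    simp only [Cmd.eval, tripleE, eval, h1, h12]
    congr 2
    split_ifs <;> omega
  have e2 : (Cmd.assign 4 (.sub (.var 3) (.var 12))).eval L
      (Function.update ρ 3 m, inputMem G D) = (ρ₁, inputMem G D) := by
    simp [Cmd.eval, eval, h12, hρ₁]
  set μ₁ := pass L (fun i μ => powE.eval L μ (Function.update ρ₁ 7 i)) L (inputMem G D) with hμ₁
  have e3 : (tabulate 7 (.var 2) powE).eval L (ρ₁, inputMem G D) =
      (Function.update ρ₁ 7 L, μ₁) :=
    eval_tabulate (x := 7) (base := .var 2) (b := L)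
      (fun μ i => (hsetup.update (x := 7) (by omega) i).L_eq) _
  have hsetup₁ := hsetup.update (x := 7) (by omega) L
  set ρ₂ := Function.update ρ₁ 7 L with hρ₂
  obtain ⟨ρ₃, hρ₃, e4⟩ := eval_loop_tabulate (L := L) (x := 7) (y := 6)
    (base := .add (.var 2) (.var 2)) (e := closureE) (ρ := ρ₂) (b := 2 * L) (by omega)
    (by simp [closureE, pairE, reachE, mod, RAM.Expr.lt, RAM.Expr.and, RAM.Expr.or, Avoids])
    (fun μ i j => by
      have := ((hsetup₁.update (x := 6) (by omega) j).update (x := 7) (by omega) i).L_eq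
      simp only [eval, this]
      omega) μ₁
  set μ₂ := (pass (2 * L) (fun i μ => closureE.eval L μ (Function.update ρ₂ 7 i)) L)^[L] μ₁
    with hμ₂
  have hsetup₂ : Setup n k m (m - d) L B ρ₃ := by
    obtain ⟨g0, g1, g2, g3, g4, g5⟩ := hsetup₁
    constructor <;> rw [hρ₃ _ (by omega) (by omega)] <;> assumption
  obtain ⟨ρ₄, hρ₄, e5⟩ := eval_loop_tabulate (L := L) (x := 7) (y := 6)
    (base := tableE) (e := configE) (ρ := ρ₃) (b := 3 * L) (by omega)
    (by simp [configE, doneE, moveE, posE, demE, digE, tgtE, tableE, pairE, reachE, mod, all,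
      RAM.Expr.eq, RAM.Expr.imp, RAM.Expr.not, RAM.Expr.lt, RAM.Expr.and, RAM.Expr.or, Avoids])
    (fun μ i j => eval_tableE ((hsetup₂.update (x := 6) (by omega) j).update (x := 7)
      (by omega) i)) μ₂
  set μ₃ := (pass (3 * L) (fun i μ => configE.eval L μ (Function.update ρ₃ 7 i)) L)^[L] μ₂
    with hμ₃
  have hsetup₃ : Setup n k m (m - d) L B ρ₄ := by
    obtain ⟨g0, g1, g2, g3, g4, g5⟩ := hsetup₂
    constructor <;> rw [hρ₄ _ (by omega) (by omega)] <;> assumption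
  -- Each stage changes only its own block of `L` cells, so what earlier stages computed can be
  -- carried along.
  have f1 : ∀ a, a < L ∨ L + L ≤ a → μ₁ a = inputMem G D a := fun a ha =>
    pass_of_notMem _ _ ha
  have f2 : ∀ a, a < 2 * L ∨ 2 * L + L ≤ a → μ₂ a = μ₁ a := fun a ha =>
    iterate_pass_of_notMem _ _ ha
  have f3 : ∀ a, a < 3 * L ∨ 3 * L + L ≤ a → μ₃ a = μ₂ a := fun a ha =>
    iterate_pass_of_notMem _ _ ha
  have p1 : ∀ j < L, μ₁ (L + j) = B ^ j :=
    powers_correct hBL hsetup.L_eq hsetup.B_eq _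
  have adj1 : HoldsAdj G μ₁ := fun u v => by
    have := pair_lt u v
    rw [f1 _ (by omega)]
    exact holdsAdj_inputMem G D u v
  have r2 : HoldsReach G L μ₂ := closure_correct hs hG hsetup₁ adj1 fun b hb => by
    rw [f1 _ (by omega), inputMem_eq_zero G D (by omega)]
  have p2 : ∀ j < L, μ₂ (L + j) = B ^ j := fun j hj => by rw [f2 _ (by omega), p1 j hj]
  have adj2 : HoldsAdj G μ₂ := fun u v => by
    have := pair_lt u v
    rw [f2 _ (by omega)]
    exact adj1 u v
  have t3 := configs_correct hs hG hsetup₂ p2 adj2 r2 fun b hb => by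
    rw [f2 _ (by omega), f1 _ (by omega), inputMem_eq_zero G D (by omega)]
  rw [← hμ₃] at t3
  have p3 : ∀ j < L, μ₃ (L + j) = B ^ j := fun j hj => by rw [f3 _ (by omega), p2 j hj]
  have r3 : HoldsReach G L μ₃ := fun u v => by
    have := pair_lt u v
    rw [f3 _ (by omega)]
    exact r2 u v
  have d3 : ∀ a < L, μ₃ a = inputMem G D a := fun a ha => by
    rw [f3 _ (by omega), f2 _ (by omega), f1 _ (by omega)]
  have hdem : HoldsDemands D μ₃ := fun i => by
    rw [d3 _ (by omega), d3 _ (by omega)]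
    exact holdsDemands_inputMem G D i
  have tar : ∀ a, IsTarget n m B μ₂ a = IsTarget n m B μ₃ a := fun a => by
    have := dig_lt (B := B) (by omega) a
    funext i v
    have := this (m + i)
    rw [IsTarget, IsTarget, f3 _ (by omega)]
  have e6 : (mainCmd.eval L (ρ, inputMem G D)).1 0 = answerE.eval L μ₃ ρ₄ := by
    -- Only sequencing is unfolded, so that `e1` to `e5` apply to whole stages.
    simp only [mainCmd, Cmd.eval.eq_3, e1, e2, e3, e4, e5]
    simp [Cmd.eval]
  rw [e6, eval_answerE hsetup₃]
  refine if_congr ?_ rfl rfl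
  rw [hasRouting_iff_exists_embedding hG hd, ← hm, holds_linkedE hs hsetup₃]
  · refine and_congr ⟨fun h i => ?_, fun h i hi => ?_⟩ ?_
    · have := h i i.2
      rw [(hdem i).1, (hdem i).2, r3] at this
      rw [exists_links_iff hG, Fin.ext_iff]
      exact this
    · have := h ⟨i, hi⟩
      rw [exists_links_iff hG, Fin.ext_iff, ← r3, ← (hdem ⟨i, hi⟩).1, ← (hdem ⟨i, hi⟩).2] at this
      exact this
    · rw [← exists_start_iff hs hG hdem]
      refine exists_congr fun a => and_congr_right fun ha => and_congr ?_ ?_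
      · have := holds_startE hs (hsetup₃.update (x := 7) (by omega) a) p3 (by simpa using ha)
        rwa [Function.update_self] at this
      · rw [t3 a ha, tar]
  · intro i hi
    rw [(hdem ⟨i, hi⟩).1]
    exact (D _).1.2.le.trans (n_le hs)

/-! ### The limit and the running time -/

/-- Sets the limit to the value of variable `x`. -/
def setLimit (x : ℕ) : Prog := .seq (.const (tmp 1) 0) (.add (tmp 0) (2 * x) (tmp 1))

theorem runs_setLimit (x : ℕ) (σ : State) :
    Runs (setLimit x) σ 2 fun τ => τ.env = σ.env ∧ τ.mem = σ.mem ∧ τ.reg 1 = σ.env x := by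
  refine Runs.mono (T := 1 + 1) ?_ le_rfl (fun _ h => h)
  refine .seq <| .const <| .add ?_
  refine ⟨?_, rfl, ?_⟩
  · funext v
    simp only [State.env, State.set_reg, tmp]
    rw [if_neg (by omega), if_neg (by omega)]
  · have : 2 * x ≠ 3 := by omega
    simp [State.env, this]

/-- Multiplies variable `2` by the power `e` of variable `5`. -/
def powerProg : ℕ → Prog
  | 0 => .const (tmp 1) 0
  | e + 1 => .seq (powerProg e) ((Cmd.assign 2 (.mul (.var 5) (.var 2))).compile 1)

/-- With limit `B`, the truncated first factor `B` is exact while the second may be arbitrarily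
large, so a multiplication takes time linear in `B` rather than in the final limit `L`. -/
theorem runs_powerProg (e : ℕ) (σ : State) (h : σ.env 5 = σ.reg 1) :
    Runs (powerProg e) σ (1 + e * (σ.reg 1 * 8 + 11)) fun τ =>
      τ.env = Function.update σ.env 2 (σ.reg 1 ^ e * σ.env 2) ∧ τ.mem = σ.mem ∧
      τ.reg 1 = σ.reg 1 := by
  induction e with
  | zero =>
    refine Runs.mono (T := 1) (.const ?_) (by omega) (fun _ h => h)
    refine ⟨?_, rfl, by simp⟩
    rw [pow_zero, one_mul, Function.update_eq_self]
    funext v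
    simp only [State.env, State.set_reg, tmp]
    rw [if_neg (by omega)]
  | succ e ih =>
    rw [Nat.add_mul, one_mul, ← add_assoc]
    refine .seq <| ih.mono le_rfl ?_
    rintro τ ⟨h1, h2, h3⟩
    refine ((Cmd.assign 2 (.mul (.var 5) (.var 2))).runs_compile le_rfl τ).mono ?_ ?_
    · simp only [Cmd.cost, Expr.cost, h3]
      omega
    · rintro κ ⟨h4, h5⟩
      simp only [Cmd.eval, Prod.mk.injEq] at h4
      have h6 : κ.reg 1 = τ.reg 1 := h5 0 (by omega)
      refine ⟨?_, h4.2.trans h2, h6.trans h3⟩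
      rw [h4.1, h1]
      simp [eval, h, h3, pow_succ']
      ring_nf

/-- The whole program. -/
def program (d : ℕ) : Prog :=
  -- The input has `k` in register `1`, which is reserved for the limit. Register `3` is zero, so
  -- this copies `k` to variable `1`.
  .seq (.add 2 1 3) <|
  .seq ((Cmd.seq (.assign 5 (.add (.add (.var 0) (.var 1)) (.const 2)))
    (.seq (.assign 2 (.const 1)) (.assign 12 (.const d)))).compile 1) <|
  .seq (setLimit 5) <| .seq (powerProg (6 * d)) <| .seq (setLimit 2) (mainCmd.compile 1)

open Classical in
theorem runs_program {n k d : ℕ} (hd : 1 ≤ d) (hdk : d < k) {G : Digraph (Fin n)}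
    (hG : IsAcyclic G) (D : Fin k → Fin n × Fin n) :
    Runs (program d) (inputState G D)
      (24 + 6 * d * ((n + k + 2) * 8 + 11) + mainCmd.cost ((n + k + 2) ^ (6 * d)))
      fun τ => τ.reg 0 = if HasRouting G (k - d) D then 1 else 0 := by
  set B := n + k + 2 with hB
  set L := B ^ (6 * d) with hL
  have hs : Sizes n k (min k (3 * d)) L B := by
    refine ⟨by omega, by omega, by omega, Nat.pow_le_pow_right (by omega) (by omega), ?_⟩
    -- `B ≥ 4` because `k ≥ 2`; `B ^ 3 ≤ L` because `d ≥ 1`.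
    calc B * B + 4 * B ≤ B * B * B := by nlinarith [show 4 ≤ B by omega]
      _ = B ^ 3 := by ring
      _ ≤ L := Nat.pow_le_pow_right (by omega) (by omega)
  refine Runs.mono (T := 1 + (18 + (2 + ((1 + 6 * d * (B * 8 + 11)) + (2 + mainCmd.cost L)))))
    ?_ (by omega) (fun _ h => h)
  refine .seq <| .add <| .seq ?_
  set σ := (inputState G D).set 2 ((inputState G D).reg 1 + (inputState G D).reg 3) with hσ
  have s0 : σ.env 0 = n := by simp [hσ, State.env, inputState]
  have s1 : σ.env 1 = k := by simp [hσ, State.env, inputState]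
  have sm : σ.mem = inputMem G D := rfl
  refine (Cmd.runs_compile _ le_rfl σ).mono (by simp [Cmd.cost, Expr.cost]) ?_
  rintro τ ⟨h1, -⟩
  simp only [Cmd.eval, eval, s0, s1, sm, Prod.mk.injEq] at h1
  obtain ⟨he, hm⟩ := h1
  refine .seq <| (runs_setLimit 5 τ).mono le_rfl ?_
  rintro τ₁ ⟨he₁, hm₁, hl₁⟩
  rw [he] at he₁ hl₁
  rw [hm] at hm₁
  have hl₁' : τ₁.reg 1 = B := by rw [hl₁]; simp [hB]
  refine .seq <| (runs_powerProg (6 * d) τ₁ (by rw [he₁, hl₁'] ; simp [hB])).mono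
    (by rw [hl₁']) ?_
  rintro τ₂ ⟨he₂, hm₂, -⟩
  rw [hl₁', he₁, ← hL] at he₂
  rw [hm₁] at hm₂
  refine .seq <| (runs_setLimit 2 τ₂).mono le_rfl ?_
  rintro τ₃ ⟨he₃, hm₃, hl₃⟩
  rw [he₂] at he₃ hl₃
  rw [hm₂] at hm₃
  have hl₃' : τ₃.reg 1 = L := by rw [hl₃]; simp
  refine (Cmd.runs_compile mainCmd le_rfl τ₃).mono (by rw [hl₃']) ?_
  rintro κ ⟨hκ, -⟩
  have : κ.reg 0 = (mainCmd.eval L (τ₃.env, inputMem G D)).1 0 := by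
    rw [hl₃', hm₃] at hκ
    exact congrFun (congrArg Prod.fst hκ) 0
  rw [this]
  refine mainCmd_correct hdk hs hG D ?_ ?_ ?_ ?_ ?_ <;> rw [he₃] <;> simp [s0, s1, hB]

end CongestionRouting

theorem theorem2 :
    ∃ C : ℕ, ∀ d : ℕ, 1 ≤ d →
      ∃ p : RAM.Prog, CongestionRouting.SolvesInTime p d (fun n => n ^ (C * d)) := by
  -- Replacing `d` and `B` by `L` in the running time gives a single function of `L`, so `K` does
  -- not depend on `d`.
  have hpoly : RAM.PolyBounded fun L =>
      24 + 6 * L * (L * 8 + 11) + CongestionRouting.mainCmd.cost L :=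
    ((RAM.PolyBounded.const 24).add (((RAM.PolyBounded.const 6).mul .id).mul
      ((RAM.PolyBounded.id.mul (.const 8)).add (.const 11)))).add
        CongestionRouting.mainCmd.polyBounded_cost
  obtain ⟨K, hK⟩ := hpoly
  refine ⟨24 * K, fun d hd => ⟨CongestionRouting.program d, fun n k G D hG hD hdk => ?_⟩⟩
  obtain ⟨τ, t, he, ht, hq⟩ := CongestionRouting.runs_program hd hdk hG D
  refine ⟨τ, t, he, ht.trans ?_, hq⟩
  have hkn : k ≤ n * n := by
    have := Fintype.card_le_of_injective D hD
    simpa using this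
  -- There are at least two distinct demands, which a single vertex cannot provide.
  have hn : 2 ≤ n := by
    by_contra h
    have : n * n ≤ 1 * 1 := Nat.mul_le_mul (by omega) (by omega)
    omega
  set B := n + k + 2 with hB
  -- `n + n ^ 2 + 2 ≤ n ^ 4` for `n ≥ 2`; hence the constant `24 = 4 * 6`.
  have hBn : B ≤ n ^ 4 := by
    have h1 : n ^ 4 = n * n * (n * n) := by ring
    nlinarith
  have hBL : B ≤ B ^ (6 * d) := Nat.le_self_pow (by omega) B
  calc 24 + 6 * d * (B * 8 + 11) + CongestionRouting.mainCmd.cost (B ^ (6 * d))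
      ≤ 24 + 6 * B ^ (6 * d) * (B ^ (6 * d) * 8 + 11) +
          CongestionRouting.mainCmd.cost (B ^ (6 * d)) := by
        gcongr
        omega
    _ ≤ (B ^ (6 * d)) ^ K := hK _ (by omega)
    _ ≤ ((n ^ 4) ^ (6 * d)) ^ K := by gcongr
    _ = n ^ (24 * K * d) := by
        rw [← pow_mul, ← pow_mul]
        congr 1
        ring
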